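/- Let $\mathcal X,\mathcal Y$ be finite alphabets and let $\{P_{Y|X}(y|x)\}$ be the transition matrix of a discrete memoryless channel, so that $P(\mathbf y|\mathbf x)=\prod_{t=1}^nP_{Y|X}(y_t|x_t)$. Let $P_X$ be a probability distribution on $\mathcal X$ and let $n\to\infty$ along an infinite set of block lengths; for each such $n$ let $P_X^{(n)}$ be the empirical distribution of some sequence in $\mathcal X^n$, with $P_X^{(n)}\to P_X$ (if $P_X$ has rational entries, one may take $P_X^{(n)}=P_X$ for all $n$ for which $nP_X$ is integer valued). Let $\mathcal T_n\subseteq\mathcal X^n$ be the type class of $P_X^{(n)}$, i.e. the set of all sequences with empirical distribution $P_X^{(n)}$. Let $0\le R_2\le R_1$, and let the integers $M=M(n)\ge2$ and $M_2=M_2(n)\ge1$ satisfy $\frac1n\ln M\to R_1-R_2$ and $\frac1n\ln M_2\to R_2$. Draw $M_1=M\cdot M_2$ codewords $\mathbf x_0,\dots,\mathbf x_{M_1-1}$ independently and uniformly from $\mathcal T_n$, and partition the code into the $M$ bins $\mathcal C_w=\{\mathbf x_{wM_2},\dots,\mathbf x_{(w+1)M_2-1}\}$, $0\le w\le M-1$.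 A codeword $\mathbf x_I$ is transmitted, with $I$ uniform on $\{0,\dots,M_1-1\}$ and independent of the code; let $\mathbf Y$ be the channel output and $W=\lfloor I/M_2\rfloor$. Consider the bin index decoders $$w^*(\mathbf y)\in\arg\max_{0\le w\le M-1}\frac1{M_2}\sum_{i=wM_2}^{(w+1)M_2-1}P(\mathbf y|\mathbf x_i),\qquad \hat w(\mathbf y)=\Big\lfloor\frac{\hat\imath_{\rm ML}(\mathbf y)}{M_2}\Big\rfloor,\quad \hat\imath_{\rm ML}(\mathbf y)\in\arg\max_{0\le i\le M_1-1}P(\mathbf y|\mathbf x_i),$$ with arbitrary tie-breaking (which may depend on the code), and let $P_e^*=\Pr\{w^*(\mathbf Y)\ne W\}$ and $\hat P_e=\Pr\{\hat w(\mathbf Y)\ne W\}$ be their error probabilities, averaged over the random code, the index $I$ and the channel. Then $P_e^*$ and $\hat P_e$ are positive for all large $n$, and both limits $\lim_{n\to\infty}-\frac1n\ln P_e^*$ and $\lim_{n\to\infty}-\frac1n\ln\hat P_e$ exist and are equal to $$E_{\rm r}(R_1)=\min_{Q_{XY}:\,Q_X=P_X}\left\{D(Q_{Y|X}\|P_{Y|X}|P_X)+[I_Q(X;Y)-R_1]_+\right\},$$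 where the minimum is attained and finite. Here $D(Q_{Y|X}\|P_{Y|X}|P_X)=\sum_xP_X(x)\sum_yQ_{Y|X}(y|x)\ln\frac{Q_{Y|X}(y|x)}{P_{Y|X}(y|x)}$ (with values in $[0,\infty]$), $I_Q(X;Y)$ is the mutual information under $Q_{XY}$, and $[x]_+=\max\{0,x\}$. In particular, both exponents are independent of $R_2$. -/

import Mathlib

open Filter Topology

noncomputable section

namespace BinIndex

variable {X Y : Type*} [Fintype X] [Fintype Y]

/-- The empirical distribution of a sequence of length `n`: the fraction of positions carrying
each letter. -/
def empirical [DecidableEq X] {n : ℕ} (x : Fin n → X) (a : X) : ℝ :=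
  ((Finset.univ.filter fun t => x t = a).card : ℝ) / (n : ℝ)

/-- The type class `T(p)`: all sequences of length `n` with empirical distribution `p`. -/
def typeClass [DecidableEq X] (n : ℕ) (p : X → ℝ) : Finset (Fin n → X) :=
  open Classical in Finset.univ.filter fun x => empirical x = p

/-- Transition probability `P(y|x)` of the memoryless channel `W`, where `W a b = P_{Y|X}(b|a)`. -/
def chanProb (W : X → Y → ℝ) {n : ℕ} (x : Fin n → X) (y : Fin n → Y) : ℝ :=
  ∏ t, W (x t) (y t)

/-- A codebook of `M * M₂` codewords of length `n`. Codeword `i` lies in the bin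
`i.divNat`, that is, in the bin with index `⌊i / M₂⌋`. -/
abbrev Codebook (X : Type*) (n M M₂ : ℕ) := Fin (M * M₂) → Fin n → X

/-- Average likelihood of the bin `w`: `P(y|C_w) = (1/M₂) * ∑_{i in bin w} P(y|x_i)`. -/
def binLikelihood (W : X → Y → ℝ) {n M M₂ : ℕ} (c : Codebook X n M M₂) (y : Fin n → Y)
    (w : Fin M) : ℝ :=
  (1 / (M₂ : ℝ)) * ∑ i ∈ Finset.univ.filter (fun i : Fin (M * M₂) => i.divNat = w),
    chanProb W (c i) y

/-- `dec` is an optimal bin index decoder: it outputs a bin of maximal average likelihood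
(ties are broken in an arbitrary way). -/
def IsOptimalBinDecoder (W : X → Y → ℝ) {n M M₂ : ℕ}
    (dec : Codebook X n M M₂ → (Fin n → Y) → Fin M) : Prop :=
  ∀ (c : Codebook X n M M₂) (y : Fin n → Y) (w : Fin M),
    binLikelihood W c y w ≤ binLikelihood W c y (dec c y)

/-- `dec` is a maximum likelihood decoder of the codeword index (ties are broken in an
arbitrary way). -/
def IsMLDecoder (W : X → Y → ℝ) {n M M₂ : ℕ}
    (dec : Codebook X n M M₂ → (Fin n → Y) → Fin (M * M₂)) : Prop :=
  ∀ (c : Codebook X n M M₂) (y : Fin n → Y) (i : Fin (M * M₂)),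
    chanProb W (c i) y ≤ chanProb W (c (dec c y)) y

/-- Error probability of the bin index decoder `dec` for the codebook `c`: the transmitted index
`i` is uniform, and the output `y` has law `P(y|x_i)`. -/
def codeErrorProb (W : X → Y → ℝ) {n M M₂ : ℕ}
    (dec : Codebook X n M M₂ → (Fin n → Y) → Fin M) (c : Codebook X n M M₂) : ℝ :=
  (1 / ((M * M₂ : ℕ) : ℝ)) * ∑ i : Fin (M * M₂),
    ∑ y ∈ Finset.univ.filter (fun y : Fin n → Y => dec c y ≠ i.divNat), chanProb W (c i) y

/-- Error probability averaged over the random code: the codewords are independent and uniform on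
`T(p)`, that is, the codebook is uniform on the codebooks with all codewords in `T(p)`. -/
def avgErrorProb [DecidableEq X] (W : X → Y → ℝ) {n M M₂ : ℕ} (p : X → ℝ)
    (dec : Codebook X n M M₂ → (Fin n → Y) → Fin M) : ℝ :=
  (1 / ((typeClass n p).card : ℝ) ^ (M * M₂)) *
    ∑ c ∈ Fintype.piFinset (fun _ : Fin (M * M₂) => typeClass n p), codeErrorProb W dec c

/-- `-(1/n) * log (P n)` tends to `E` along `l` (with `P n` eventually positive, so that the
logarithm is genuine). -/
def HasExponent (l : Filter ℕ) (P : ℕ → ℝ) (E : ℝ) : Prop :=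
  (∀ᶠ n in l, 0 < P n) ∧ Tendsto (fun n : ℕ => -Real.log (P n) / (n : ℝ)) l (𝓝 E)

/-- First marginal of a joint distribution. -/
def margX (Q : X → Y → ℝ) (x : X) : ℝ := ∑ y, Q x y

/-- Second marginal of a joint distribution. -/
def margY (Q : X → Y → ℝ) (y : Y) : ℝ := ∑ x, Q x y

/-- The conditional distribution `Q_{Y|X}` of a joint distribution (the zero row at letters of
zero probability, which carry no weight below). -/
def condYX (Q : X → Y → ℝ) (x : X) (y : Y) : ℝ := Q x y / margX Q x

/-- The weighted divergence `D(V‖W|p)`, with `0 log (0/b) = 0` and `a log (a/0) = ∞` for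
`a > 0`. -/
def condDiv (p : X → ℝ) (V W : X → Y → ℝ) : EReal :=
  open Classical in
  if ∃ x y, 0 < p x ∧ 0 < V x y ∧ W x y = 0 then ⊤
  else ((∑ x, p x * ∑ y, V x y * Real.log (V x y / W x y) : ℝ) : EReal)

/-- The mutual information `I_Q(X;Y)`. -/
def mutualInfo (Q : X → Y → ℝ) : ℝ :=
  ∑ x, ∑ y, Q x y * Real.log (Q x y / (margX Q x * margY Q y))

/-- The joint distributions `Q_{XY}` with `Q_X = p`, for a probability distribution `p`. -/
def jointsWithMarginal (p : X → ℝ) : Set (X → Y → ℝ) :=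
  {Q | (∀ x y, 0 ≤ Q x y) ∧ ∑ x, ∑ y, Q x y = 1 ∧ margX Q = p}

/-- The objective `D(Q_{Y|X}‖W|p) + [I_Q(X;Y) - R]_+`. -/
def exponentObjective (W : X → Y → ℝ) (p : X → ℝ) (R : ℝ) (Q : X → Y → ℝ) : EReal :=
  condDiv p (condYX Q) W + ((max 0 (mutualInfo Q - R) : ℝ) : EReal)

/-- `E` is the random coding exponent `E_r(R)`, the minimum of the objective over all `Q_{XY}`
with `Q_X = p`. -/
def IsRandomCodingExponent (W : X → Y → ℝ) (p : X → ℝ) (R E : ℝ) : Prop :=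
  IsLeast (exponentObjective W p R '' jointsWithMarginal p) (E : EReal)

end BinIndex

end

noncomputable section

namespace BinIndex

/-! ### Sizes of type classes -/

/-! The optimal bin decoder errs no more often than the decoder that reduces the ML codeword to its
bin. It therefore suffices to bound every bin decoder from below and the ML decoder from above by
the same exponent. Both bounds are expressed through one quantity per joint type, `typeBound`: the
average probability that the sent codeword and the output have that joint type, times `min 1 (N p)`.
Here `N` is the total number of codewords and `p` is the chance that an independent codeword has the
same joint type with the output. Stirling's formula gives it the exponent `D + [I - R]_+` with `R =
log N / n`, and `R` tends to `R₁`.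

Lower bound (`typeBound_div_le_avgErrorProb`): fix `y` and a joint type. The codewords in the
corresponding conditional class all have the same likelihood, so whichever bin is selected, those
outside it are lost. Two of them in different bins cannot both be saved. A moment argument
(`sum_pairs_le`, `codeAvg_card_outside_ge`) shows that on average at least a constant times `N p
min(1, N p)` are lost. Only `N` and the presence of at least two bins matter here, hence the
independence of `R₂`.

Upper bound (`avgErrorProb_isMLDecoder_le`): a bin error is a codeword error, and ML is the best
codeword decoder, hence at least as good as choosing the codeword with the smallest conditional
class (for inputs of a fixed type, essentially maximal empirical mutual information). The sequences
ranked no worse than `x` form polynomially many classes, each no larger than that of `x`, so a union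
bound truncated at 1 gives `min 1 (N p)` up to a polynomial factor.

There are only polynomially many joint types. Written through entropies, the objective is continuous
on the compact set of joint distributions supported by the channel. Hence the minimum is attained;
types near a minimizer give the lower bound, and uniform lower semicontinuity in the marginal and
the rate gives the upper bound. -/

/-- The number of occurrences of the letter `a` in the sequence `z`. -/
def letterCount {A : Type*} [DecidableEq A] {n : ℕ} (z : Fin n → A) (a : A) : ℕ :=
  (Finset.univ.filter fun t => z t = a).card

/-- The Shannon entropy of a distribution on a finite alphabet. -/
def entropy {A : Type*} [Fintype A] (p : A → ℝ) : ℝ := ∑ a, Real.negMulLog (p a)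

section TypeClass

variable {A B : Type*} [DecidableEq A] [DecidableEq B] {n : ℕ}

theorem mem_typeClass [Fintype A] {p : A → ℝ} {z : Fin n → A} :
    z ∈ typeClass n p ↔ empirical z = p := by
  simp [typeClass]

theorem empirical_eq (z : Fin n → A) (a : A) : empirical z a = letterCount z a / n := rfl

theorem sum_letterCount [Fintype A] (z : Fin n → A) : ∑ a, letterCount z a = n := by
  have := Finset.card_eq_sum_card_fiberwise (f := z) (s := Finset.univ) (t := Finset.univ)
    (fun _ _ => Finset.mem_coe.2 (Finset.mem_univ _))
  simpa [letterCount] using this.symm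

theorem letterCount_le (z : Fin n → A) (a : A) : letterCount z a ≤ n := by
  simpa [letterCount] using Finset.card_le_univ (Finset.univ.filter fun t => z t = a)

theorem mul_empirical (hn : 0 < n) (z : Fin n → A) (a : A) :
    (n : ℝ) * empirical z a = letterCount z a := by
  rw [empirical_eq]; field_simp

theorem letterCount_eq_of_empirical_eq {z z' : Fin n → A} (h : empirical z = empirical z') :
    letterCount z = letterCount z' := by
  rcases Nat.eq_zero_or_pos n with rfl | hn
  · funext a; simp [letterCount]
  · funext a
    have := mul_empirical hn z a
    rw [h, mul_empirical hn z' a] at this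
    exact_mod_cast this.symm

theorem letterCount_comp_perm (z : Fin n → A) (σ : Equiv.Perm (Fin n)) :
    letterCount (z ∘ σ) = letterCount z := by
  funext a
  refine Finset.card_bij (fun t _ => σ t) ?_ ?_ ?_
  · intro t ht; simpa using ht
  · intro t _ t' _ h; exact σ.injective h
  · intro t ht; exact ⟨σ.symm t, by simpa using ht, by simp⟩

theorem empirical_comp_perm (z : Fin n → A) (σ : Equiv.Perm (Fin n)) :
    empirical (z ∘ σ) = empirical z := by
  funext a; rw [empirical_eq, empirical_eq, letterCount_comp_perm]

/-- Bijections between fibres of equal size glue to a permutation of positions. Type classes are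
thus single orbits, so quantities invariant under permuting positions are constant on them. -/
theorem exists_perm_of_letterCount_eq {z z' : Fin n → A} (h : letterCount z = letterCount z') :
    ∃ σ : Equiv.Perm (Fin n), z ∘ σ = z' := by
  have e : ∀ a, Nonempty ({t // z' t = a} ≃ {t // z t = a}) := fun a => by
    apply Fintype.card_eq.1
    rw [Fintype.card_subtype, Fintype.card_subtype]
    exact (congrFun h a).symm
  exact ⟨Equiv.ofFiberEquiv fun a => Classical.choice (e a),
    funext fun t => Equiv.ofFiberEquiv_map _ t⟩

theorem exists_perm_of_empirical_eq {z z' : Fin n → A} (h : empirical z = empirical z') :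
    ∃ σ : Equiv.Perm (Fin n), z ∘ σ = z' :=
  exists_perm_of_letterCount_eq (letterCount_eq_of_empirical_eq h)

/-- Orbit-stabilizer: the permutations carrying `z` to a given sequence of its type form a coset of
the stabilizer, which permutes the positions of each letter separately. -/
theorem card_typeClass_mul_prod_factorial [Fintype A] (z : Fin n → A) :
    (typeClass n (empirical z)).card * ∏ a, (letterCount z a).factorial = n.factorial := by
  have h1 : (Finset.univ : Finset (Equiv.Perm (Fin n))).card = n.factorial := by
    simp [Fintype.card_perm]
  rw [← h1, Finset.card_eq_sum_card_fiberwise (f := fun σ : Equiv.Perm (Fin n) => z ∘ σ)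
    (t := typeClass n (empirical z)), Finset.sum_congr rfl, Finset.sum_const, smul_eq_mul]
  · intro z' hz'
    rw [mem_typeClass] at hz'
    obtain ⟨σ, rfl⟩ := exists_perm_of_empirical_eq hz'.symm
    have h2 := DomMulAct.stabilizer_card (f := z)
    rw [Fintype.card_subtype] at h2
    have h3 : ∀ a, Fintype.card {t // z t = a} = letterCount z a := fun a =>
      Fintype.card_subtype _
    simp only [h3] at h2
    rw [← h2]
    refine Finset.card_bij (fun g _ => g * σ⁻¹) ?_ ?_ ?_
    · intro g hg
      simp only [Finset.mem_filter, Finset.mem_univ, true_and] at hg ⊢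
      funext t
      simpa using congrFun hg (σ⁻¹ t)
    · intro g _ g' _ h; exact mul_right_cancel h
    · intro g hg
      refine ⟨g * σ, ?_, by simp⟩
      simp only [Finset.mem_filter, Finset.mem_univ, true_and] at hg ⊢
      funext t
      exact congrFun hg (σ t)
  · intro σ _
    simp [mem_typeClass, empirical_comp_perm]

/-- Each count takes one of `n + 1` values. This polynomial bound makes every union over types free
in the exponent. -/
theorem card_image_empirical_le [Fintype A] (s : Finset (Fin n → A)) [DecidableEq (A → ℝ)] :
    (s.image empirical).card ≤ (n + 1) ^ Fintype.card A := by
  have h : s.image empirical ⊆ (Finset.univ : Finset (A → Fin (n + 1))).image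
      (fun k a => ((k a : ℕ) : ℝ) / n) := by
    intro p hp
    obtain ⟨z, _, rfl⟩ := Finset.mem_image.1 hp
    refine Finset.mem_image.2 ⟨fun a => ⟨letterCount z a, Nat.lt_succ_of_le (letterCount_le z a)⟩,
      Finset.mem_univ _, rfl⟩
  refine (Finset.card_le_card h).trans (Finset.card_image_le.trans ?_)
  simp

/-- The sequences `x` for which `(x, y)` has the joint type of `(x₀, y)`. -/
def condClass [Fintype A] (x₀ : Fin n → A) (y : Fin n → B) : Finset (Fin n → A) :=
  open Classical in Finset.univ.filter fun x =>
    empirical (fun t => (x t, y t)) = empirical (fun t => (x₀ t, y t))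

theorem mem_condClass [Fintype A] {x₀ x : Fin n → A} {y : Fin n → B} :
    x ∈ condClass x₀ y ↔
      empirical (fun t => (x t, y t)) = empirical (fun t => (x₀ t, y t)) := by
  simp [condClass]

theorem sum_empirical_fst [Fintype B] (z : Fin n → A × B) (a : A) :
    ∑ b, empirical z (a, b) = empirical (fun t => (z t).1) a := by
  simp only [empirical_eq, ← Finset.sum_div]
  congr 1
  norm_cast
  have := Finset.card_eq_sum_card_fiberwise (f := fun t => (z t).2)
    (s := Finset.univ.filter fun t => (z t).1 = a) (t := Finset.univ)
    (fun _ _ => Finset.mem_coe.2 (Finset.mem_univ _))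
  rw [letterCount, this]
  refine Finset.sum_congr rfl fun b _ => ?_
  rw [letterCount, Finset.filter_filter]
  simp only [Prod.ext_iff]

theorem sum_empirical_snd [Fintype A] (z : Fin n → A × B) (b : B) :
    ∑ a, empirical z (a, b) = empirical (fun t => (z t).2) b := by
  simp only [empirical_eq, ← Finset.sum_div]
  congr 1
  norm_cast
  have := Finset.card_eq_sum_card_fiberwise (f := fun t => (z t).1)
    (s := Finset.univ.filter fun t => (z t).2 = b) (t := Finset.univ)
    (fun _ _ => Finset.mem_coe.2 (Finset.mem_univ _))
  rw [letterCount, this]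
  refine Finset.sum_congr rfl fun b _ => ?_
  rw [letterCount, Finset.filter_filter]
  simp only [Prod.ext_iff, and_comm]

theorem empirical_fst_eq [Fintype B] {z z' : Fin n → A × B} (h : empirical z = empirical z') :
    empirical (fun t => (z t).1) = empirical (fun t => (z' t).1) := by
  funext a; rw [← sum_empirical_fst, ← sum_empirical_fst, h]

theorem empirical_snd_eq [Fintype A] {z z' : Fin n → A × B} (h : empirical z = empirical z') :
    empirical (fun t => (z t).2) = empirical (fun t => (z' t).2) := by
  funext a; rw [← sum_empirical_snd, ← sum_empirical_snd, h]

/-- The joint type class fibres over the type class of `y`; a permutation carrying `y` to `y'`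
carries one fibre onto the other, so all fibres have the size of `condClass x y`. -/
theorem card_condClass_mul [Fintype A] [Fintype B] (x : Fin n → A) (y : Fin n → B) :
    (typeClass n (empirical y)).card * (condClass x y).card =
      (typeClass n (empirical fun t => (x t, y t))).card := by
  rw [Finset.card_eq_sum_card_fiberwise (s := typeClass n (empirical fun t => (x t, y t)))
    (f := fun (z : Fin n → A × B) t => (z t).2)
    (t := typeClass n (empirical y)), Finset.sum_congr rfl, Finset.sum_const, smul_eq_mul]
  · intro y' hy'
    obtain ⟨σ, rfl⟩ := exists_perm_of_empirical_eq (mem_typeClass.1 hy').symm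
    refine Finset.card_bij (fun z _ t => (z (σ.symm t)).1) ?_ ?_ ?_
    · intro z hz
      simp only [Finset.mem_filter, mem_typeClass] at hz
      rw [mem_condClass, ← hz.1, ← empirical_comp_perm z σ.symm]
      congr 1
      funext t
      have := congrFun hz.2 (σ.symm t)
      simp only [Function.comp, Equiv.apply_symm_apply] at this ⊢
      rw [← this]
    · intro z hz z' hz' h
      simp only [Finset.mem_filter, mem_typeClass] at hz hz'
      funext t
      refine Prod.ext ?_ ((congrFun hz.2 t).trans (congrFun hz'.2 t).symm)
      simpa using congrFun h (σ t)
    · intro x' hx'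
      rw [mem_condClass] at hx'
      refine ⟨(fun t => (x' t, y t)) ∘ σ, ?_, ?_⟩
      · simp only [Finset.mem_filter, mem_typeClass]
        rw [empirical_comp_perm]
        exact ⟨hx', rfl⟩
      · funext t; simp
  · intro z hz
    simp only [Finset.mem_coe, mem_typeClass] at hz ⊢
    exact empirical_snd_eq hz

theorem exists_empirical_eq [Fintype A] (k : A → ℕ) (hk : ∑ a, k a = n) :
    ∃ z : Fin n → A, letterCount z = k := by
  have e : Fintype.card (Fin n) = Fintype.card (Σ a, Fin (k a)) := by simp [hk]
  let e := Fintype.equivOfCardEq e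
  refine ⟨fun t => (e t).1, funext fun a => ?_⟩
  rw [letterCount, ← Fintype.card_subtype, ← Fintype.card_fin (k a)]
  exact Fintype.card_congr ((e.subtypeEquiv (q := fun s => s.1 = a) fun t => Iff.rfl).trans
    (Equiv.sigmaSubtype a))

end TypeClass

/-! ### Entropy estimates -/

theorem mul_log_sub_le_log_factorial (k : ℕ) :
    (k : ℝ) * Real.log k - k ≤ Real.log k.factorial := by
  rcases Nat.eq_zero_or_pos k with rfl | hk
  · simp
  have hk' : (0 : ℝ) < k := by exact_mod_cast hk
  have hf : (0 : ℝ) < k.factorial := by exact_mod_cast k.factorial_pos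
  have h := Real.pow_div_factorial_le_exp (x := k) hk'.le k
  have := Real.log_le_log (by positivity) h
  rw [Real.log_exp, Real.log_div (by positivity) hf.ne', Real.log_pow] at this
  linarith

theorem log_factorial_le (k : ℕ) :
    Real.log k.factorial ≤ (k : ℝ) * Real.log k - k + (1 + Real.log (k + 1)) := by
  -- The induction runs with the sharper error `1 + log k` for `k = m + 1`; its step amounts to `log
  -- ((m+2)/(m+1)) ≥ 1/(m+2)`.
  have key : ∀ m : ℕ, Real.log (m + 1).factorial ≤
      ((m + 1 : ℕ) : ℝ) * Real.log (m + 1 : ℕ) - (m + 1 : ℕ) + (1 + Real.log (m + 1 : ℕ)) := by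
    intro m
    induction m with
    | zero => simp
    | succ m ih =>
      have hm : (0 : ℝ) < (m : ℝ) + 1 := by positivity
      have hm2 : (0 : ℝ) < (m : ℝ) + 1 + 1 := by positivity
      have hf : (0 : ℝ) < (m + 1).factorial := by exact_mod_cast (m + 1).factorial_pos
      rw [Nat.factorial_succ, Nat.cast_mul, Real.log_mul (by positivity) hf.ne']
      have h1 := Real.one_sub_inv_le_log_of_pos (x := ((m : ℝ) + 1 + 1) / (m + 1)) (by positivity)
      rw [Real.log_div hm2.ne' hm.ne', inv_div] at h1
      have h2 : 1 - ((m : ℝ) + 1) / (m + 1 + 1) = 1 / (m + 1 + 1) := by field_simp; ring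
      rw [h2, div_le_iff₀ hm2] at h1
      push_cast at ih ⊢
      nlinarith
  rcases Nat.eq_zero_or_pos k with rfl | hk
  · simp
  obtain ⟨m, rfl⟩ := Nat.exists_eq_succ_of_ne_zero hk.ne'
  refine (key m).trans ?_
  have : Real.log ((m + 1 : ℕ) : ℝ) ≤ Real.log (((m + 1 : ℕ) : ℝ) + 1) :=
    Real.log_le_log (by positivity) (by linarith)
  simp only [Nat.succ_eq_add_one]
  linarith

/-- The logarithm of the size of a type class is `n` times the entropy of the type, up to a
logarithmic term. -/
theorem abs_log_card_typeClass_sub_le {A : Type*} [DecidableEq A] [Fintype A] {n : ℕ}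
    (hn : 0 < n) (z : Fin n → A) :
    |Real.log (typeClass n (empirical z)).card - n * entropy (empirical z)| ≤
      (Fintype.card A + 1) * (1 + Real.log (n + 1)) := by
  have hn' : (0 : ℝ) < n := by exact_mod_cast hn
  have hpos : (typeClass n (empirical z)).card ≠ 0 :=
    Finset.card_ne_zero_of_mem (mem_typeClass.2 rfl)
  have hmain : Real.log (typeClass n (empirical z)).card +
      ∑ a, Real.log (letterCount z a).factorial = Real.log n.factorial := by
    rw [← card_typeClass_mul_prod_factorial z, Nat.cast_mul, Nat.cast_prod,
      Real.log_mul (by exact_mod_cast hpos)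
        (Finset.prod_ne_zero_iff.2 fun a _ => by exact_mod_cast (Nat.factorial_ne_zero _)),
      Real.log_prod fun a _ => by exact_mod_cast (Nat.factorial_ne_zero _)]
  have hsum : ∑ a, (letterCount z a : ℝ) = n := by exact_mod_cast sum_letterCount z
  have hent : (n : ℝ) * entropy (empirical z) =
      n * Real.log n - ∑ a, (letterCount z a : ℝ) * Real.log (letterCount z a) := by
    rw [entropy, Finset.mul_sum]
    conv_rhs => rw [← hsum, Finset.sum_mul, hsum]
    rw [← Finset.sum_sub_distrib]
    refine Finset.sum_congr rfl fun a _ => ?_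
    rw [Real.negMulLog, neg_mul, mul_neg, ← mul_assoc, mul_empirical hn, empirical_eq]
    rcases Nat.eq_zero_or_pos (letterCount z a) with h | h
    · simp [h]
    · rw [Real.log_div (by positivity) hn'.ne']; ring
  have hL : 0 ≤ 1 + Real.log ((n : ℝ) + 1) := by
    have := Real.log_nonneg (x := (n : ℝ) + 1) (by linarith)
    linarith
  have hlo : ∑ a, ((letterCount z a : ℝ) * Real.log (letterCount z a) - letterCount z a) ≤
      ∑ a, Real.log (letterCount z a).factorial :=
    Finset.sum_le_sum fun a _ => mul_log_sub_le_log_factorial _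
  have hup : ∑ a, Real.log (letterCount z a).factorial ≤
      ∑ a, ((letterCount z a : ℝ) * Real.log (letterCount z a) - letterCount z a +
        (1 + Real.log (n + 1))) := by
    refine Finset.sum_le_sum fun a _ => (log_factorial_le _).trans ?_
    have : (letterCount z a : ℝ) ≤ n := by exact_mod_cast letterCount_le z a
    have := Real.log_le_log (x := (letterCount z a : ℝ) + 1) (y := n + 1) (by positivity)
      (by linarith)
    linarith
  rw [Finset.sum_sub_distrib, hsum] at hlo
  rw [Finset.sum_add_distrib, Finset.sum_sub_distrib, hsum, Finset.sum_const, nsmul_eq_mul,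
    Finset.card_univ] at hup
  have h1 := mul_log_sub_le_log_factorial n
  have h2 := log_factorial_le n
  have h3 : 0 ≤ (Fintype.card A : ℝ) * (1 + Real.log (n + 1)) := by positivity
  rw [hent, abs_le]
  constructor <;> linarith

/-! ### Averages over independent uniform codewords -/

/-- For indices coloured by `β` and a selected colour `d`, the weight outside of `d` controls the
weight of the pairs of different colours. -/
theorem sum_pairs_le {ι γ : Type*} [Fintype ι] [DecidableEq γ] (β : ι → γ) (d : γ) (e : ι → ℝ)
    (he : ∀ i, 0 ≤ e i) {κ : ℝ} (hκ : 0 < κ) :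
    ∑ i, ∑ j ∈ Finset.univ.filter (fun j => β j ≠ β i),
      (1 / κ * (e i * e j) - 1 / (2 * κ ^ 2) * ∑ k, e i * e j * e k) ≤
      ∑ i ∈ Finset.univ.filter (fun i => β i ≠ d), e i := by
  set S := ∑ i, e i with hS
  set b := ∑ i ∈ Finset.univ.filter (fun i => β i ≠ d), e i with hb
  set D := ∑ i, ∑ j ∈ Finset.univ.filter (fun j => β j ≠ β i), e i * e j with hD
  have hS0 : 0 ≤ S := Finset.sum_nonneg fun i _ => he i
  have hb0 : 0 ≤ b := Finset.sum_nonneg fun i _ => he i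
  have hD0 : 0 ≤ D := Finset.sum_nonneg fun i _ => Finset.sum_nonneg fun j _ =>
    mul_nonneg (he i) (he j)
  have hbe : b = ∑ i, if β i ≠ d then e i else 0 := by rw [hb, Finset.sum_filter]
  -- Of two indices of different colours, at least one is not of colour `d`.
  have hDle : D ≤ 2 * S * b := by
    calc D ≤ ∑ i, ∑ j, ((if β i ≠ d then e i else 0) * e j + e i * (if β j ≠ d then e j else 0)) := by
          refine Finset.sum_le_sum fun i _ => ?_
          rw [Finset.sum_filter]
          refine Finset.sum_le_sum fun j _ => ?_
          have hij := mul_nonneg (he i) (he j)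
          by_cases h1 : β i = d <;> by_cases h2 : β j = d <;> simp [h1, h2] <;>
            split_ifs <;> linarith
      _ = 2 * S * b := by
          simp only [Finset.sum_add_distrib, ← Finset.mul_sum, ← Finset.sum_mul, ← hbe, ← hS]
          ring
  -- So `b ≥ D / (2S)`. The factor `1/κ - S/(2κ²)` is the tangent to the convex function `1/(2S)` at
  -- `S = κ`; it replaces the ratio by a cubic polynomial in `e`, whose average is computable.
  have hlhs : ∑ i, ∑ j ∈ Finset.univ.filter (fun j => β j ≠ β i),
      (1 / κ * (e i * e j) - 1 / (2 * κ ^ 2) * ∑ k, e i * e j * e k) =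
      D * (1 / κ - 1 / (2 * κ ^ 2) * S) := by
    rw [hD, Finset.sum_mul]
    refine Finset.sum_congr rfl fun i _ => ?_
    rw [Finset.sum_mul]
    refine Finset.sum_congr rfl fun j _ => ?_
    rw [← Finset.mul_sum, ← hS]
    ring
  rw [hlhs]
  rcases le_or_gt (1 / κ - 1 / (2 * κ ^ 2) * S) 0 with hf | hf
  · exact (mul_nonpos_of_nonneg_of_nonpos hD0 hf).trans hb0
  · calc D * (1 / κ - 1 / (2 * κ ^ 2) * S) ≤ 2 * S * b * (1 / κ - 1 / (2 * κ ^ 2) * S) :=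
          mul_le_mul_of_nonneg_right hDle hf.le
      _ = b * (1 - (1 - S / κ) ^ 2) := by field_simp; ring
      _ ≤ b * 1 := mul_le_mul_of_nonneg_left (by nlinarith [sq_nonneg (1 - S / κ)]) hb0
      _ = b := mul_one b

section Average

variable {ι α : Type*} [Fintype ι] [DecidableEq ι]

/-- The average of `f` over a family of independent elements that are uniform on `T`. -/
def codeAvg (T : Finset α) (f : (ι → α) → ℝ) : ℝ :=
  (1 / (T.card : ℝ) ^ Fintype.card ι) * ∑ c ∈ Fintype.piFinset (fun _ : ι => T), f c

theorem codeAvg_mono {T : Finset α} {f g : (ι → α) → ℝ}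
    (h : ∀ c, (∀ i, c i ∈ T) → f c ≤ g c) : codeAvg T f ≤ codeAvg T g :=
  mul_le_mul_of_nonneg_left
    (Finset.sum_le_sum fun c hc => h c (Fintype.mem_piFinset.1 hc)) (by positivity)

theorem codeAvg_sum {κ : Type*} (T : Finset α) (s : Finset κ) (f : κ → (ι → α) → ℝ) :
    codeAvg T (fun c => ∑ k ∈ s, f k c) = ∑ k ∈ s, codeAvg T (f k) := by
  simp only [codeAvg]
  rw [Finset.sum_comm, Finset.mul_sum]

theorem codeAvg_const_mul (T : Finset α) (a : ℝ) (f : (ι → α) → ℝ) :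
    codeAvg T (fun c => a * f c) = a * codeAvg T f := by
  simp only [codeAvg, ← Finset.mul_sum]; ring

theorem codeAvg_sub (T : Finset α) (f g : (ι → α) → ℝ) :
    codeAvg T (fun c => f c - g c) = codeAvg T f - codeAvg T g := by
  simp only [codeAvg, Finset.sum_sub_distrib]; ring

/-- This is the independence of the codewords. -/
theorem codeAvg_prod (T : Finset α) (g : ι → α → ℝ) :
    codeAvg T (fun c => ∏ i, g i (c i)) = ∏ i, (∑ x ∈ T, g i x) / (T.card : ℝ) := by
  rw [codeAvg, ← Finset.prod_univ_sum, Finset.prod_div_distrib, Finset.prod_const,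
    Finset.card_univ]
  ring

theorem codeAvg_indicators [DecidableEq α] {T : Finset α} (hT : T.Nonempty) (s : Finset ι) (A : ι → Finset α)
    (hA : ∀ i, A i ⊆ T) :
    codeAvg T (fun c => ∏ i ∈ s, if c i ∈ A i then (1 : ℝ) else 0) =
      ∏ i ∈ s, ((A i).card : ℝ) / (T.card : ℝ) := by
  have hT' : (T.card : ℝ) ≠ 0 := by exact_mod_cast hT.card_pos.ne'
  have h := codeAvg_prod T fun (i : ι) x => if i ∈ s then (if x ∈ A i then (1 : ℝ) else 0) else 1
  simp only [Finset.prod_ite_mem, Finset.univ_inter] at h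
  rw [h]
  conv_rhs => rw [← Finset.univ_inter s, ← Finset.prod_ite_mem]
  refine Finset.prod_congr rfl fun i _ => ?_
  by_cases hi : i ∈ s
  · simp [hi, Finset.inter_eq_right.2 (hA i)]
  · simp [hi, hT']

theorem codeAvg_indicator_pair [DecidableEq α] {T : Finset α} (hT : T.Nonempty) {A B : Finset α} (hA : A ⊆ T)
    (hB : B ⊆ T) {i j : ι} (hij : i ≠ j) :
    codeAvg T (fun c => (if c i ∈ A then (1 : ℝ) else 0) * (if c j ∈ B then (1 : ℝ) else 0)) =
      (A.card : ℝ) / T.card * (B.card / T.card) := by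
  have h := codeAvg_indicators hT {i, j} (fun k => if k = i then A else B)
    (fun k => by by_cases h : k = i <;> simp [h, hA, hB])
  simpa [Finset.prod_pair hij, hij.symm] using h

theorem codeAvg_indicator [DecidableEq α] {T : Finset α} (hT : T.Nonempty) {A : Finset α} (hA : A ⊆ T) (i : ι) :
    codeAvg T (fun c => if c i ∈ A then (1 : ℝ) else 0) = (A.card : ℝ) / T.card := by
  simpa using codeAvg_indicators hT {i} (fun _ => A) (fun _ => hA)

/-- A third index costs an extra factor `p` unless it repeats one of the first two. Summed over `k`
this gives `p² (2 + N p)`. -/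
theorem codeAvg_indicator_triple_le [DecidableEq α] {T : Finset α} (hT : T.Nonempty) {A : Finset α} (hA : A ⊆ T)
    {i j : ι} (hij : i ≠ j) (k : ι) :
    codeAvg T (fun c => (if c i ∈ A then (1 : ℝ) else 0) * (if c j ∈ A then (1 : ℝ) else 0) *
        (if c k ∈ A then (1 : ℝ) else 0)) ≤
      (if k = i then ((A.card : ℝ) / T.card) ^ 2 else 0) +
        (if k = j then ((A.card : ℝ) / T.card) ^ 2 else 0) + ((A.card : ℝ) / T.card) ^ 3 := by
  have h2 := codeAvg_indicator_pair hT hA hA hij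
  have h3 : 0 ≤ ((A.card : ℝ) / T.card) ^ 3 := by positivity
  by_cases hki : k = i
  · subst hki
    have : ∀ c : ι → α, (if c k ∈ A then (1 : ℝ) else 0) * (if c j ∈ A then (1 : ℝ) else 0) *
        (if c k ∈ A then (1 : ℝ) else 0) =
        (if c k ∈ A then (1 : ℝ) else 0) * (if c j ∈ A then (1 : ℝ) else 0) := fun c => by
      by_cases h : c k ∈ A <;> simp [h]
    simp only [this, h2, if_neg hij, if_true]
    nlinarith
  by_cases hkj : k = j
  · subst hkj
    have : ∀ c : ι → α, (if c i ∈ A then (1 : ℝ) else 0) * (if c k ∈ A then (1 : ℝ) else 0) *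
        (if c k ∈ A then (1 : ℝ) else 0) =
        (if c i ∈ A then (1 : ℝ) else 0) * (if c k ∈ A then (1 : ℝ) else 0) := fun c => by
      by_cases h : c k ∈ A <;> simp [h]
    simp only [this, h2, if_neg hki, if_true]
    nlinarith
  have h := codeAvg_indicators hT {i, j, k} (fun _ => A) (fun _ => hA)
  rw [Finset.prod_const, Finset.card_eq_three.2 ⟨i, j, k, hij, Ne.symm hki, Ne.symm hkj, rfl⟩] at h
  have h' : ∀ c : ι → α, ∏ l ∈ ({i, j, k} : Finset ι), (if c l ∈ A then (1 : ℝ) else 0) =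
      (if c i ∈ A then (1 : ℝ) else 0) * (if c j ∈ A then (1 : ℝ) else 0) *
        (if c k ∈ A then (1 : ℝ) else 0) := fun c => by
    rw [Finset.prod_insert (by simp [hij, Ne.symm hki]), Finset.prod_pair (Ne.symm hkj), mul_assoc]
  simp only [h'] at h
  rw [h, if_neg hki, if_neg hkj]
  linarith

/-- Whatever colour is selected, the average number of indices of the other colours whose element
falls into `A` is at least of the order `N p min(1, N p)`. -/
theorem codeAvg_card_outside_ge [DecidableEq α] {γ : Type*} [DecidableEq γ] (β : ι → γ)
    (hβ : ∀ i, (Fintype.card ι : ℝ) / 2 ≤ (Finset.univ.filter fun j => β j ≠ β i).card)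
    {T A : Finset α} (hT : T.Nonempty) (hA : A ⊆ T) (d : (ι → α) → γ) :
    Fintype.card ι * ((A.card : ℝ) / T.card) *
        min 1 (Fintype.card ι * ((A.card : ℝ) / T.card)) / 12 ≤
      codeAvg T (fun c => ∑ i ∈ Finset.univ.filter (fun i => β i ≠ d c),
        if c i ∈ A then (1 : ℝ) else 0) := by
  set N := (Fintype.card ι : ℝ) with hN
  set p : ℝ := (A.card : ℝ) / T.card with hp
  have hN0 : 0 ≤ N := by positivity
  have hp0 : 0 ≤ p := by positivity
  -- The tangent point bounds the mean number of hits given that two fixed codewords hit `A`. With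
  -- it the cubic correction takes away at most half of the main term `p²/κ`.
  set κ : ℝ := 2 + N * p with hκ
  have hκ0 : 0 < κ := by positivity
  refine le_trans ?_ (codeAvg_mono (f := fun c => ∑ i, ∑ j ∈ Finset.univ.filter (fun j => β j ≠ β i),
      (1 / κ * ((if c i ∈ A then (1 : ℝ) else 0) * (if c j ∈ A then (1 : ℝ) else 0)) -
        1 / (2 * κ ^ 2) * ∑ k, (if c i ∈ A then (1 : ℝ) else 0) *
          (if c j ∈ A then (1 : ℝ) else 0) * (if c k ∈ A then (1 : ℝ) else 0)))
    fun c _ => sum_pairs_le β (d c)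
    (fun i => if c i ∈ A then (1 : ℝ) else 0) (fun i => by positivity) hκ0)
  rw [codeAvg_sum]
  simp only [codeAvg_sum, codeAvg_sub, codeAvg_const_mul]
  have hterm : ∀ i, ∀ j ∈ Finset.univ.filter (fun j => β j ≠ β i), p ^ 2 / (2 * κ) ≤
      1 / κ * codeAvg T (fun c : ι → α =>
        (if c i ∈ A then (1 : ℝ) else 0) * (if c j ∈ A then (1 : ℝ) else 0)) -
      1 / (2 * κ ^ 2) * ∑ k, codeAvg T (fun c : ι → α => (if c i ∈ A then (1 : ℝ) else 0) *
        (if c j ∈ A then (1 : ℝ) else 0) * (if c k ∈ A then (1 : ℝ) else 0)) := by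
    intro i j hj
    have hij : i ≠ j := by
      rintro rfl; simp at hj
    rw [codeAvg_indicator_pair hT hA hA hij, ← hp]
    have h3 : ∑ k, codeAvg T (fun c : ι → α => (if c i ∈ A then (1 : ℝ) else 0) *
        (if c j ∈ A then (1 : ℝ) else 0) * (if c k ∈ A then (1 : ℝ) else 0)) ≤ p ^ 2 * κ := by
      refine (Finset.sum_le_sum fun k _ => codeAvg_indicator_triple_le hT hA hij k).trans ?_
      simp only [Finset.sum_add_distrib, Finset.sum_ite_eq', Finset.mem_univ, if_true,
        Finset.sum_const, Finset.card_univ, nsmul_eq_mul, ← hp, ← hN]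
      rw [hκ]; apply le_of_eq; ring
    have h4 := mul_le_mul_of_nonneg_left h3 (by positivity : 0 ≤ 1 / (2 * κ ^ 2))
    have h5 : 1 / (2 * κ ^ 2) * (p ^ 2 * κ) = p ^ 2 / (2 * κ) := by field_simp
    have h6 : 1 / κ * (p * p) = 2 * (p ^ 2 / (2 * κ)) := by field_simp
    linarith
  have hsum : N * (N / 2) * (p ^ 2 / (2 * κ)) ≤ ∑ i : ι,
      ∑ j ∈ Finset.univ.filter (fun j => β j ≠ β i), p ^ 2 / (2 * κ) := by
    simp only [Finset.sum_const, nsmul_eq_mul]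
    have : N * (N / 2) * (p ^ 2 / (2 * κ)) = ∑ i : ι, N / 2 * (p ^ 2 / (2 * κ)) := by
      rw [Finset.sum_const, Finset.card_univ, nsmul_eq_mul, ← hN]; ring
    rw [this]
    exact Finset.sum_le_sum fun i _ => mul_le_mul_of_nonneg_right (hβ i) (by positivity)
  refine le_trans ?_ (hsum.trans
    (Finset.sum_le_sum fun i _ => Finset.sum_le_sum fun j hj => hterm i j hj))
  have hu : 0 ≤ N * p := by positivity
  -- The constant 12 is `2 · 2 · 3`: half of the indices lie in other colours, half of `p²/κ`
  -- survives, and this inequality costs 3.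
  have hmin : min 1 (N * p) * κ ≤ 3 * (N * p) := by
    rw [hκ]
    rcases le_total 1 (N * p) with h | h
    · rw [min_eq_left h]; linarith
    · rw [min_eq_right h]; nlinarith
  have : N * (N / 2) * (p ^ 2 / (2 * κ)) = N * p * (3 * (N * p) / κ) / 12 := by
    field_simp; ring
  rw [this]
  have : min 1 (N * p) ≤ 3 * (N * p) / κ := by rwa [le_div_iff₀ hκ0]
  gcongr

/-- Union bound for the event that another codeword scores at most as much as the codeword `i`. -/
theorem codeAvg_competitor_le [DecidableEq α] {T : Finset α} (hT : T.Nonempty) (i : ι) (g : α → ℝ)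
    (hg : ∀ x, 0 ≤ g x) (f : α → ℕ)
    [DecidablePred fun c : ι → α => ∃ k, k ≠ i ∧ f (c k) ≤ f (c i)] :
    codeAvg T (fun c : ι → α => if ∃ k, k ≠ i ∧ f (c k) ≤ f (c i) then g (c i) else 0) ≤
      1 / (T.card : ℝ) * ∑ x ∈ T, g x *
        min 1 (Fintype.card ι * (((T.filter fun x' => f x' ≤ f x).card : ℝ) / T.card)) := by
  -- Splitting by the value `x` of codeword `i` turns the competitor condition into membership of
  -- another, independent codeword in a fixed set.
  have h1 : ∀ c : ι → α, (∀ j, c j ∈ T) →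
      (if ∃ k, k ≠ i ∧ f (c k) ≤ f (c i) then g (c i) else 0) ≤
      ∑ x ∈ T, g x * ((if c i ∈ ({x} : Finset α) then (1 : ℝ) else 0) *
        (if ∃ k, k ≠ i ∧ c k ∈ T.filter (fun x' => f x' ≤ f x) then 1 else 0)) := by
    intro c hc
    refine le_trans (le_of_eq ?_) (Finset.single_le_sum (fun x _ => ?_) (hc i))
    · simp [hc]
    · have := hg x
      positivity
  refine (codeAvg_mono h1).trans ?_
  rw [codeAvg_sum, Finset.mul_sum]
  refine Finset.sum_le_sum fun x hx => ?_
  rw [codeAvg_const_mul, mul_left_comm]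
  refine mul_le_mul_of_nonneg_left ?_ (hg x)
  set B := T.filter fun x' => f x' ≤ f x with hB
  have hx' : ({x} : Finset α) ⊆ T := Finset.singleton_subset_iff.2 hx
  rw [mul_min_of_nonneg _ _ (by positivity), le_min_iff]
  constructor
  · refine (codeAvg_mono (g := fun c => if c i ∈ ({x} : Finset α) then (1 : ℝ) else 0)
      fun c _ => ?_).trans ?_
    · split_ifs <;> simp
    · rw [codeAvg_indicator hT hx']; simp
  · have h2 : ∀ c : ι → α, (∀ j, c j ∈ T) → (if c i ∈ ({x} : Finset α) then (1 : ℝ) else 0) *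
        (if ∃ k, k ≠ i ∧ c k ∈ B then 1 else 0) ≤ ∑ k ∈ Finset.univ.filter (fun k => k ≠ i),
          (if c i ∈ ({x} : Finset α) then (1 : ℝ) else 0) * (if c k ∈ B then (1 : ℝ) else 0) := by
      intro c _
      by_cases h : ∃ k, k ≠ i ∧ c k ∈ B
      · obtain ⟨k, hk, hkB⟩ := h
        refine le_trans (le_of_eq ?_) (Finset.single_le_sum (fun k _ => by positivity)
          (Finset.mem_filter.2 ⟨Finset.mem_univ k, hk⟩))
        rw [if_pos hkB, if_pos (show ∃ k, k ≠ i ∧ c k ∈ B from ⟨k, hk, hkB⟩)]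
      · rw [if_neg h, mul_zero]
        exact Finset.sum_nonneg fun k _ => by positivity
    refine (codeAvg_mono h2).trans ?_
    rw [codeAvg_sum]
    have h3 : ∀ k ∈ Finset.univ.filter (fun k => k ≠ i), codeAvg T (fun c : ι → α =>
        (if c i ∈ ({x} : Finset α) then (1 : ℝ) else 0) * (if c k ∈ B then (1 : ℝ) else 0)) =
        1 / (T.card : ℝ) * (B.card / T.card) := fun k hk => by
      rw [codeAvg_indicator_pair hT hx' (Finset.filter_subset _ _)
        (Ne.symm (Finset.mem_filter.1 hk).2), Finset.card_singleton, Nat.cast_one]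
    rw [Finset.sum_congr rfl h3, Finset.sum_const, nsmul_eq_mul]
    have h4 : ((Finset.univ.filter fun k => k ≠ i).card : ℝ) ≤ Fintype.card ι := by
      exact_mod_cast Finset.card_le_univ _
    calc _ ≤ (Fintype.card ι : ℝ) * (1 / (T.card : ℝ) * (B.card / T.card)) :=
          mul_le_mul_of_nonneg_right h4 (by positivity)
      _ = _ := by ring

end Average

/-! ### Error probabilities and joint types -/

section ErrorBounds

theorem chanProb_nonneg {X Y : Type*} {W : X → Y → ℝ} (hW : ∀ x y, 0 ≤ W x y) {n : ℕ} (x : Fin n → X)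
    (y : Fin n → Y) : 0 ≤ chanProb W x y :=
  Finset.prod_nonneg fun _ _ => hW _ _

theorem chanProb_eq_of_empirical_eq {X Y : Type*} [DecidableEq X] [DecidableEq Y] (W : X → Y → ℝ) {n : ℕ}
    {z z' : Fin n → X × Y} (h : empirical z = empirical z') :
    chanProb W (fun t => (z t).1) (fun t => (z t).2) =
      chanProb W (fun t => (z' t).1) (fun t => (z' t).2) := by
  obtain ⟨σ, rfl⟩ := exists_perm_of_empirical_eq h
  exact (Equiv.prod_comp σ fun t => W (z t).1 (z t).2).symm

theorem card_bin (M M₂ : ℕ) (w : Fin M) :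
    (Finset.univ.filter fun i : Fin (M * M₂) => i.divNat = w).card = M₂ := by
  have hdiv : ∀ a b, (finProdFinEquiv (m := M) (n := M₂) (a, b)).divNat = a := fun a b =>
    congrArg Prod.fst (finProdFinEquiv.symm_apply_apply (a, b))
  refine (Finset.card_bij (s := (Finset.univ : Finset (Fin M₂)))
    (fun j _ => finProdFinEquiv (w, j)) ?_ ?_ ?_).symm.trans (Finset.card_fin M₂)
  · intro j _; simp only [Finset.mem_filter, Finset.mem_univ, true_and, hdiv]
  · intro j _ j' _ h; exact (Prod.mk.inj (finProdFinEquiv.injective h)).2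
  · intro i hi
    obtain ⟨⟨a, b⟩, rfl⟩ := finProdFinEquiv.surjective i
    simp only [Finset.mem_filter, Finset.mem_univ, true_and, hdiv] at hi
    exact ⟨b, Finset.mem_univ _, by rw [hi]⟩

/-- Deleting one of at least two equal bins leaves at least half of the indices. The lower bound
uses no other feature of the binning. -/
theorem half_le_card_outside_bin {M M₂ : ℕ} (hM : 2 ≤ M) (i : Fin (M * M₂)) :
    (Fintype.card (Fin (M * M₂)) : ℝ) / 2 ≤
      (Finset.univ.filter fun j : Fin (M * M₂) => j.divNat ≠ i.divNat).card := by
  have h := Finset.card_filter_add_card_filter_not (s := (Finset.univ : Finset (Fin (M * M₂))))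
    (fun j => j.divNat = i.divNat)
  rw [card_bin, Finset.card_univ, Fintype.card_fin] at h
  have h' : (M₂ : ℝ) + (Finset.univ.filter fun j : Fin (M * M₂) => j.divNat ≠ i.divNat).card =
      (M : ℝ) * M₂ := by exact_mod_cast h
  have hM' : (2 : ℝ) ≤ M := by exact_mod_cast hM
  have h0 : (0 : ℝ) ≤ M₂ := by positivity
  rw [Fintype.card_fin]
  push_cast
  nlinarith

theorem codeErrorProb_eq {X Y : Type*} [Fintype Y] (W : X → Y → ℝ) {n M M₂ : ℕ}
    (dec : Codebook X n M M₂ → (Fin n → Y) → Fin M) (c : Codebook X n M M₂) :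
    codeErrorProb W dec c = (1 / ((M * M₂ : ℕ) : ℝ)) * ∑ y : Fin n → Y,
      ∑ i ∈ Finset.univ.filter (fun i => i.divNat ≠ dec c y), chanProb W (c i) y := by
  rw [codeErrorProb]
  congr 1
  simp only [Finset.sum_filter]
  rw [Finset.sum_comm]
  simp only [ne_comm]

/-- For fixed `y` the lost mass is the total minus the mass of the chosen bin, so maximizing the bin
likelihood minimizes the error output by output. -/
theorem sum_outside_bin_eq {X Y : Type*} (W : X → Y → ℝ) {n M M₂ : ℕ} (hM₂ : 1 ≤ M₂) (c : Codebook X n M M₂)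
    (y : Fin n → Y) (w : Fin M) :
    ∑ i ∈ Finset.univ.filter (fun i : Fin (M * M₂) => i.divNat ≠ w), chanProb W (c i) y =
      ∑ i, chanProb W (c i) y - M₂ * binLikelihood W c y w := by
  have h0 : (M₂ : ℝ) ≠ 0 := by positivity
  rw [binLikelihood, ← mul_assoc, mul_one_div_cancel h0, one_mul, eq_sub_iff_add_eq, add_comm]
  exact Finset.sum_filter_add_sum_filter_not _ _ _

/-- Under maximum likelihood decoding, an error is as unlikely as under the decoder that selects
the codeword with the smallest conditional type class. -/
theorem sum_outside_bin_isMLDecoder_le {X Y : Type*} {W : X → Y → ℝ} (hW : ∀ x y, 0 ≤ W x y) {n M M₂ : ℕ}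
    {dec : Codebook X n M M₂ → (Fin n → Y) → Fin (M * M₂)} (hdec : IsMLDecoder W dec)
    (f : (Fin n → X) → ℕ) (c : Codebook X n M M₂) (y : Fin n → Y) :
    ∑ i ∈ Finset.univ.filter (fun i : Fin (M * M₂) => i.divNat ≠ (dec c y).divNat),
        chanProb W (c i) y ≤
      ∑ i, if ∃ k, k ≠ i ∧ f (c k) ≤ f (c i) then chanProb W (c i) y else 0 := by
  obtain ⟨j, -, hj⟩ := Finset.exists_min_image (Finset.univ : Finset (Fin (M * M₂)))
    (fun i => f (c i)) ⟨dec c y, Finset.mem_univ _⟩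
  have h1 : ∑ i ∈ Finset.univ.filter (fun i : Fin (M * M₂) => i.divNat ≠ (dec c y).divNat),
      chanProb W (c i) y ≤ ∑ i ∈ Finset.univ.erase (dec c y), chanProb W (c i) y := by
    refine Finset.sum_le_sum_of_subset_of_nonneg (fun i hi => ?_)
      fun i _ _ => chanProb_nonneg hW _ _
    refine Finset.mem_erase.2 ⟨?_, Finset.mem_univ _⟩
    rintro rfl
    simp at hi
  -- ML saves the largest likelihood, so saving the index `j` of smallest score instead loses at
  -- least as much. Then `j` is a competitor of every lost index.
  have h2 : ∑ i ∈ Finset.univ.erase (dec c y), chanProb W (c i) y ≤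
      ∑ i ∈ Finset.univ.erase j, chanProb W (c i) y := by
    have e1 := Finset.add_sum_erase Finset.univ (fun i => chanProb W (c i) y)
      (Finset.mem_univ (dec c y))
    have e2 := Finset.add_sum_erase Finset.univ (fun i => chanProb W (c i) y) (Finset.mem_univ j)
    have := hdec c y j
    linarith
  refine h1.trans (h2.trans ?_)
  refine le_trans (Finset.sum_le_sum fun i hi => ?_)
    (Finset.sum_le_sum_of_subset_of_nonneg (Finset.subset_univ (Finset.univ.erase j))
      fun i _ _ => ?_)
  · rw [if_pos ⟨j, (Finset.ne_of_mem_erase hi).symm, hj i (Finset.mem_univ _)⟩]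
  · have := chanProb_nonneg hW (c i) y
    positivity

variable {X Y : Type*} [Fintype X] [Fintype Y]

theorem avgErrorProb_eq [DecidableEq X] (W : X → Y → ℝ) {n M M₂ : ℕ} (p : X → ℝ)
    (dec : Codebook X n M M₂ → (Fin n → Y) → Fin M) :
    avgErrorProb W p dec = codeAvg (typeClass n p) (codeErrorProb W dec) := by
  rw [avgErrorProb, codeAvg, Fintype.card_fin]

/-- The optimal bin index decoder has the smallest error probability. -/
theorem avgErrorProb_le_of_isOptimal [DecidableEq X] (W : X → Y → ℝ) {n M M₂ : ℕ}
    (hM₂ : 1 ≤ M₂) (p : X → ℝ) {dec : Codebook X n M M₂ → (Fin n → Y) → Fin M}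
    (hdec : IsOptimalBinDecoder W dec) (dec' : Codebook X n M M₂ → (Fin n → Y) → Fin M) :
    avgErrorProb W p dec ≤ avgErrorProb W p dec' := by
  rw [avgErrorProb_eq, avgErrorProb_eq]
  refine codeAvg_mono fun c _ => ?_
  rw [codeErrorProb_eq, codeErrorProb_eq]
  refine mul_le_mul_of_nonneg_left (Finset.sum_le_sum fun y _ => ?_) (by positivity)
  rw [sum_outside_bin_eq W hM₂, sum_outside_bin_eq W hM₂]
  have := mul_le_mul_of_nonneg_left (hdec c y (dec' c y)) (Nat.cast_nonneg (α := ℝ) M₂)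
  linarith

variable [DecidableEq X] [DecidableEq Y]

/-- The contribution of the joint type of `(x, y)` to the error probability of a random code
with `N` codewords. -/
def typeBound (W : X → Y → ℝ) (N : ℕ) {n : ℕ} (x : Fin n → X) (y : Fin n → Y) : ℝ :=
  ((typeClass n (empirical fun t => (x t, y t))).card : ℝ) / (typeClass n (empirical x)).card *
    chanProb W x y *
    min 1 (N * (((condClass x y).card : ℝ) / (typeClass n (empirical x)).card))

theorem condClass_subset {n : ℕ} (x : Fin n → X) (y : Fin n → Y) :
    condClass x y ⊆ typeClass n (empirical x)  := fun _ hx' =>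
  mem_typeClass.2 (empirical_fst_eq (mem_condClass.1 hx'))

/-- Lower bound for the error probability of every bin index decoder by the contribution of one
joint type. -/
theorem typeBound_div_le_avgErrorProb {W : X → Y → ℝ} (hW : ∀ x y, 0 ≤ W x y) {n M M₂ : ℕ}
    (hM : 2 ≤ M) (hM₂ : 1 ≤ M₂) {p : X → ℝ}
    (dec : Codebook X n M M₂ → (Fin n → Y) → Fin M) (x : Fin n → X) (y : Fin n → Y)
    (hx : empirical x = p) :
    typeBound W (M * M₂) x y / 12 ≤ avgErrorProb W p dec := by
  subst hx
  have hN : (0 : ℝ) < ((M * M₂ : ℕ) : ℝ) := by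
    have : 0 < M * M₂ := by positivity
    exact_mod_cast this
  have hT : (typeClass n (empirical x)).Nonempty := ⟨x, mem_typeClass.2 rfl⟩
  rw [avgErrorProb_eq]
  simp only [funext (codeErrorProb_eq W dec), codeAvg_const_mul]
  rw [codeAvg_sum]
  -- Every `y'` of the type of `y` contributes equally: a permutation transports the conditional
  -- class, and all codewords in it have likelihood `chanProb W x y`.
  have key : ∀ y' ∈ typeClass n (empirical y),
      chanProb W x y * (((M * M₂ : ℕ) : ℝ) *
        (((condClass x y).card : ℝ) / (typeClass n (empirical x)).card) *
        min 1 (((M * M₂ : ℕ) : ℝ) *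
          (((condClass x y).card : ℝ) / (typeClass n (empirical x)).card)) / 12) ≤
      codeAvg (typeClass n (empirical x)) (fun c : Codebook X n M M₂ =>
        ∑ i ∈ Finset.univ.filter (fun i => i.divNat ≠ dec c y'), chanProb W (c i) y') := by
    intro y' hy'
    obtain ⟨σ, rfl⟩ := exists_perm_of_empirical_eq (mem_typeClass.1 hy').symm
    have hz : empirical (fun t => ((x ∘ σ) t, (y ∘ σ) t)) = empirical fun t => (x t, y t) :=
      empirical_comp_perm (fun t => (x t, y t)) σ
    have hsub : condClass (x ∘ σ) (y ∘ σ) ⊆ typeClass n (empirical x) := by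
      rw [← empirical_comp_perm x σ]; exact condClass_subset _ _
    have hcard : (condClass (x ∘ σ) (y ∘ σ)).card = (condClass x y).card := by
      have h1 := card_condClass_mul x y
      have h2 := card_condClass_mul (x ∘ σ) (y ∘ σ)
      rw [hz, ← h1, empirical_comp_perm] at h2
      exact Nat.eq_of_mul_eq_mul_left (Finset.card_pos.2 ⟨y, mem_typeClass.2 rfl⟩) h2
    have h := codeAvg_card_outside_ge (fun i : Fin (M * M₂) => i.divNat)
      (half_le_card_outside_bin hM) hT hsub (fun c => dec c (y ∘ σ))
    rw [hcard, Fintype.card_fin] at h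
    refine (mul_le_mul_of_nonneg_left h (chanProb_nonneg hW x y)).trans ?_
    rw [← codeAvg_const_mul]
    refine codeAvg_mono fun c _ => ?_
    rw [Finset.mul_sum]
    refine Finset.sum_le_sum fun i _ => ?_
    split_ifs with hi
    · rw [mul_one]
      exact (chanProb_eq_of_empirical_eq W ((mem_condClass.1 hi).trans hz)).ge
    · rw [mul_zero]; exact chanProb_nonneg hW _ _
  have hsum := (Finset.sum_le_sum key).trans
    (Finset.sum_le_sum_of_subset_of_nonneg (Finset.subset_univ _) fun y' _ _ => by
      have h0 := codeAvg_mono (T := typeClass n (empirical x)) (f := fun _ => 0)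
        (g := fun c : Codebook X n M M₂ =>
          ∑ i ∈ Finset.univ.filter (fun i => i.divNat ≠ dec c y'), chanProb W (c i) y')
        fun c _ => Finset.sum_nonneg fun i _ => chanProb_nonneg hW _ _
      simpa [codeAvg] using h0)
  refine le_trans (le_of_eq ?_) (mul_le_mul_of_nonneg_left hsum (by positivity))
  rw [Finset.sum_const, nsmul_eq_mul, typeBound, ← card_condClass_mul x y, Nat.cast_mul]
  field_simp

/-- The set lies in a union of conditional classes of size at most `m`, one per joint type. Ranking
by class size thus keeps the set of competitors of `x` nearly as small as the class of `x`. -/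
theorem card_filter_condClass_le {n : ℕ} (T : Finset (Fin n → X)) (y : Fin n → Y) (m : ℕ) :
    (T.filter fun x => (condClass x y).card ≤ m).card ≤
      m * (n + 1) ^ Fintype.card (X × Y) := by
  classical
  refine (Finset.card_le_mul_card_image (f := fun x => empirical fun t => (x t, y t)) _ m
    fun q hq => ?_).trans (Nat.mul_le_mul_left _ ?_)
  · obtain ⟨x, hx, rfl⟩ := Finset.mem_image.1 hq
    refine (Finset.card_le_card fun x' hx' => ?_).trans (Finset.mem_filter.1 hx).2
    exact mem_condClass.2 (Finset.mem_filter.1 hx').2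
  · have h := card_image_empirical_le
      ((T.filter fun x => (condClass x y).card ≤ m).image fun x t => (x t, y t))
    rwa [Finset.image_image] at h

/-- The terms of one type add up to at most 1, so the sum is at most the number of types. -/
theorem sum_inv_card_typeClass_le {A : Type*} [Fintype A] [DecidableEq A] {n : ℕ}
    (s : Finset (Fin n → A)) :
    ∑ z ∈ s, 1 / ((typeClass n (empirical z)).card : ℝ) ≤ (n + 1 : ℝ) ^ Fintype.card A := by
  classical
  rw [← Finset.sum_fiberwise_of_maps_to (g := empirical) (t := s.image empirical)
    fun z hz => Finset.mem_image_of_mem _ hz]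
  have h : ∀ q ∈ s.image empirical, ∑ z ∈ s.filter (fun z => empirical z = q),
      1 / ((typeClass n (empirical z)).card : ℝ) ≤ 1 := by
    intro q _
    rw [Finset.sum_congr rfl (g := fun _ => 1 / ((typeClass n q).card : ℝ))
      fun z hz => by rw [(Finset.mem_filter.1 hz).2], Finset.sum_const, nsmul_eq_mul, mul_one_div]
    refine div_le_one_of_le₀ ?_ (by positivity)
    exact_mod_cast Finset.card_le_card fun z hz => mem_typeClass.2 (Finset.mem_filter.1 hz).2
  refine (Finset.sum_le_sum h).trans ?_
  rw [Finset.sum_const, nsmul_eq_mul, mul_one]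
  exact_mod_cast card_image_empirical_le s

/-- Upper bound for the error probability of the maximum likelihood decoder by the largest
contribution of a joint type. -/
theorem avgErrorProb_isMLDecoder_le {W : X → Y → ℝ} (hW : ∀ x y, 0 ≤ W x y) {n M M₂ : ℕ}
    (hM : 2 ≤ M) (hM₂ : 1 ≤ M₂) {p : X → ℝ} (hp : (typeClass n p).Nonempty)
    {dec : Codebook X n M M₂ → (Fin n → Y) → Fin (M * M₂)} (hdec : IsMLDecoder W dec)
    {b : ℝ} (hb0 : 0 ≤ b) (hb : ∀ x y, empirical x = p → typeBound W (M * M₂) (n := n) x y ≤ b) :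
    avgErrorProb W p (fun c y => (dec c y).divNat) ≤
      ((n + 1 : ℝ) ^ Fintype.card (X × Y)) ^ 2 * b := by
  set K : ℝ := (n + 1 : ℝ) ^ Fintype.card (X × Y) with hK
  have hK1 : 1 ≤ K := one_le_pow₀ (by linarith [Nat.cast_nonneg (α := ℝ) n])
  set T := typeClass n p with hTdef
  have hT0 : (0 : ℝ) < T.card := by exact_mod_cast hp.card_pos
  have hN : (0 : ℝ) < ((M * M₂ : ℕ) : ℝ) := by
    have : 0 < M * M₂ := by positivity
    exact_mod_cast this
  rw [avgErrorProb_eq]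
  simp only [funext (codeErrorProb_eq W _), codeAvg_const_mul]
  rw [codeAvg_sum]
  -- This `K` pays for the competitor set. The weights `1 / |class|` let the sum over all pairs cost
  -- only one more `K`, whence `K ^ 2`.
  have key : ∀ y : Fin n → Y, codeAvg T (fun c : Codebook X n M M₂ =>
      ∑ i ∈ Finset.univ.filter (fun i => i.divNat ≠ (dec c y).divNat), chanProb W (c i) y) ≤
      ((M * M₂ : ℕ) : ℝ) * ∑ x ∈ T,
        K * b * (1 / ((typeClass n (empirical fun t => (x t, y t))).card : ℝ)) := by
    intro y
    refine (codeAvg_mono fun c _ =>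
      sum_outside_bin_isMLDecoder_le hW hdec (fun x => (condClass x y).card) c y).trans ?_
    rw [codeAvg_sum]
    refine (Finset.sum_le_sum fun i _ => codeAvg_competitor_le hp i (fun x => chanProb W x y)
      (fun x => chanProb_nonneg hW x y) (fun x => (condClass x y).card)).trans ?_
    rw [Finset.sum_const, Finset.card_univ, Fintype.card_fin, nsmul_eq_mul, Finset.mul_sum]
    refine mul_le_mul_of_nonneg_left (Finset.sum_le_sum fun x hx => ?_) hN.le
    have hx' := mem_typeClass.1 hx
    have hL : (0 : ℝ) < (typeClass n (empirical fun t => (x t, y t))).card := by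
      exact_mod_cast Finset.card_pos.2 ⟨_, mem_typeClass.2 rfl⟩
    have h2 : (((T.filter fun x' => (condClass x' y).card ≤ (condClass x y).card).card : ℕ) : ℝ) ≤
        K * (condClass x y).card := by
      have := card_filter_condClass_le T y (condClass x y).card
      rw [hK, mul_comm]
      exact_mod_cast this
    have h3 : min 1 (((M * M₂ : ℕ) : ℝ) *
        (((T.filter fun x' => (condClass x' y).card ≤ (condClass x y).card).card : ℝ) / T.card)) ≤
        K * min 1 (((M * M₂ : ℕ) : ℝ) * (((condClass x y).card : ℝ) / T.card)) := by
      rw [mul_min_of_nonneg _ _ (by linarith : (0 : ℝ) ≤ K)]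
      refine min_le_min (by linarith) ?_
      calc _ ≤ ((M * M₂ : ℕ) : ℝ) * (K * (condClass x y).card / T.card) := by gcongr
        _ = _ := by ring
    have h4 := hb x y hx'
    unfold typeBound at h4
    rw [hx', ← hTdef] at h4
    calc _ ≤ 1 / (T.card : ℝ) * (chanProb W x y *
          (K * min 1 (((M * M₂ : ℕ) : ℝ) * (((condClass x y).card : ℝ) / T.card)))) := by
          refine mul_le_mul_of_nonneg_left (mul_le_mul_of_nonneg_left h3
            (chanProb_nonneg hW x y)) (by positivity)
      _ = K * (((typeClass n (empirical fun t => (x t, y t))).card : ℝ) / T.card *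
          chanProb W x y * min 1 (((M * M₂ : ℕ) : ℝ) * (((condClass x y).card : ℝ) / T.card))) *
          (1 / ((typeClass n (empirical fun t => (x t, y t))).card : ℝ)) := by
          field_simp
      _ ≤ _ := by gcongr
  refine (mul_le_mul_of_nonneg_left (Finset.sum_le_sum fun y _ => key y) (by positivity)).trans ?_
  rw [← Finset.mul_sum, ← mul_assoc, one_div_mul_cancel hN.ne', one_mul]
  simp only [← Finset.mul_sum]
  have h5 : ∑ y : Fin n → Y, ∑ x ∈ T,
      1 / ((typeClass n (empirical fun t => (x t, y t))).card : ℝ) ≤ K := by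
    rw [← Finset.sum_product']
    refine le_trans (le_of_eq ?_) (sum_inv_card_typeClass_le
      ((Finset.univ ×ˢ T).image fun (w : (Fin n → Y) × (Fin n → X)) t => (w.2 t, w.1 t)))
    rw [Finset.sum_image]
    intro w _ w' _ h
    have h' := fun t => congrFun h t
    simp only [Prod.mk.injEq] at h'
    exact Prod.ext (funext fun t => (h' t).2) (funext fun t => (h' t).1)
  calc _ ≤ K * b * K := mul_le_mul_of_nonneg_left h5 (by positivity)
    _ = _ := by ring

end ErrorBounds

/-! ### The exponent as a continuous function of the joint distribution -/

section Exponent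

variable {X Y : Type*} [Fintype X] [Fintype Y]

/-- The divergence `D(Q_{Y|X}‖W|Q_X)` of a joint distribution supported in the support of `W`,
written through entropies. -/
def entropyDiv (W : X → Y → ℝ) (Q : X → Y → ℝ) : ℝ :=
  entropy (margX Q) - (∑ x, ∑ y, Real.negMulLog (Q x y)) - ∑ x, ∑ y, Q x y * Real.log (W x y)

/-- The mutual information written through entropies. -/
def entropyInfo (Q : X → Y → ℝ) : ℝ :=
  entropy (margX Q) + entropy (margY Q) - ∑ x, ∑ y, Real.negMulLog (Q x y)

/-- The real-valued objective of the random coding exponent. -/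
def realObjective (W : X → Y → ℝ) (r : ℝ) (Q : X → Y → ℝ) : ℝ :=
  entropyDiv W Q + max 0 (entropyInfo Q - r)

/-- The joint distributions whose support lies in the support of `W`. -/
def supportedJoints (W : X → Y → ℝ) : Set (X → Y → ℝ) :=
  {Q | (∀ x y, 0 ≤ Q x y) ∧ ∑ x, ∑ y, Q x y = 1 ∧ ∀ x y, W x y = 0 → Q x y = 0}

theorem continuous_margX {X Y : Type*} [Fintype Y] : Continuous (margX : (X → Y → ℝ) → X → ℝ) := by
  unfold margX; fun_prop

theorem continuous_margY {X Y : Type*} [Fintype X] : Continuous (margY : (X → Y → ℝ) → Y → ℝ) := by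
  unfold margY; fun_prop

theorem continuous_entropy {A : Type*} [Fintype A] : Continuous (entropy : (A → ℝ) → ℝ) := by
  unfold entropy
  exact continuous_finsetSum _ fun a _ => Real.continuous_negMulLog.comp (continuous_apply a)

/-- In entropy form the only singular function is `negMulLog`, continuous at 0; the logarithms of
`W` are constants. -/
theorem continuous_realObjective (W : X → Y → ℝ) :
    Continuous fun s : (X → Y → ℝ) × ℝ => realObjective W s.2 s.1 := by
  have h1 : Continuous fun Q : X → Y → ℝ => ∑ x, ∑ y, Real.negMulLog (Q x y) :=
    continuous_finsetSum _ fun x _ => continuous_finsetSum _ fun y _ =>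
      Real.continuous_negMulLog.comp (by fun_prop)
  have h2 := continuous_entropy.comp (continuous_margX (X := X) (Y := Y))
  have h3 := continuous_entropy.comp (continuous_margY (X := X) (Y := Y))
  have h4 : Continuous (entropyDiv W) := by
    refine (h2.sub h1).sub ?_
    fun_prop
  have h5 : Continuous (entropyInfo : (X → Y → ℝ) → ℝ) := (h2.add h3).sub h1
  exact (h4.comp continuous_fst).add
    (continuous_const.max ((h5.comp continuous_fst).sub continuous_snd))

theorem isCompact_supportedJoints (W : X → Y → ℝ) : IsCompact (supportedJoints W) := by
  refine (isCompact_Icc (a := (0 : X → Y → ℝ)) (b := 1)).of_isClosed_subset ?_ ?_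
  · have : supportedJoints W = (⋂ x, ⋂ y, {Q | 0 ≤ Q x y}) ∩ ({Q | ∑ x, ∑ y, Q x y = 1} ∩
        ⋂ x, ⋂ y, {Q | W x y = 0 → Q x y = 0}) := by
      ext Q; simp [supportedJoints]
    rw [this]
    refine (isClosed_iInter fun x => isClosed_iInter fun y =>
      isClosed_le continuous_const (by fun_prop)).inter ((isClosed_eq (by fun_prop)
      continuous_const).inter (isClosed_iInter fun x => isClosed_iInter fun y => ?_))
    by_cases h : W x y = 0
    · simpa [h] using isClosed_eq (by fun_prop) continuous_const
    · simp [h]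
  · rintro Q ⟨h0, h1, -⟩
    refine ⟨h0, fun x y => ?_⟩
    calc Q x y ≤ ∑ y, Q x y :=
          Finset.single_le_sum (f := fun y => Q x y) (fun y _ => h0 x y) (Finset.mem_univ y)
      _ ≤ ∑ x, ∑ y, Q x y := Finset.single_le_sum (f := fun x => ∑ y, Q x y)
          (fun x _ => Finset.sum_nonneg fun y _ => h0 x y) (Finset.mem_univ x)
      _ = 1 := h1

theorem le_margX {X Y : Type*} [Fintype Y] {Q : X → Y → ℝ} (h : ∀ x y, 0 ≤ Q x y) (x : X) (y : Y) : Q x y ≤ margX Q x :=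
  Finset.single_le_sum (f := fun y => Q x y) (fun y _ => h x y) (Finset.mem_univ y)

theorem le_margY {X Y : Type*} [Fintype X] {Q : X → Y → ℝ} (h : ∀ x y, 0 ≤ Q x y) (x : X) (y : Y) : Q x y ≤ margY Q y :=
  Finset.single_le_sum (f := fun x => Q x y) (fun x _ => h x y) (Finset.mem_univ x)

theorem entropy_margX_eq (Q : X → Y → ℝ) :
    entropy (margX Q) = -∑ x, ∑ y, Q x y * Real.log (margX Q x) := by
  rw [entropy, ← Finset.sum_neg_distrib]
  refine Finset.sum_congr rfl fun x _ => ?_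
  rw [← Finset.sum_mul, Real.negMulLog, neg_mul]
  rfl

theorem entropy_margY_eq (Q : X → Y → ℝ) :
    entropy (margY Q) = -∑ x, ∑ y, Q x y * Real.log (margY Q y) := by
  rw [Finset.sum_comm, entropy, ← Finset.sum_neg_distrib]
  refine Finset.sum_congr rfl fun y _ => ?_
  rw [← Finset.sum_mul, Real.negMulLog, neg_mul]
  rfl

theorem mutualInfo_eq {Q : X → Y → ℝ} (h : ∀ x y, 0 ≤ Q x y) :
    mutualInfo Q = entropyInfo Q := by
  rw [mutualInfo, entropyInfo, entropy_margX_eq, entropy_margY_eq, ← neg_add,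
    ← Finset.sum_add_distrib, ← Finset.sum_neg_distrib, ← Finset.sum_sub_distrib]
  refine Finset.sum_congr rfl fun x _ => ?_
  rw [← Finset.sum_add_distrib, ← Finset.sum_neg_distrib, ← Finset.sum_sub_distrib]
  refine Finset.sum_congr rfl fun y _ => ?_
  rcases (h x y).eq_or_lt with h0 | h0
  · simp [← h0]
  · have h1 := h0.trans_le (le_margX h x y)
    have h2 := h0.trans_le (le_margY h x y)
    rw [Real.log_div h0.ne' (by positivity), Real.log_mul h1.ne' h2.ne', Real.negMulLog]
    ring

theorem exponentObjective_eq {W : X → Y → ℝ} {p : X → ℝ} {Q : X → Y → ℝ}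
    (hQ : Q ∈ supportedJoints W) (hp : margX Q = p) (R : ℝ) :
    exponentObjective W p R Q = (realObjective W R Q : EReal) := by
  subst hp
  obtain ⟨h0, -, h2⟩ := hQ
  have hno : ¬ ∃ x y, 0 < margX Q x ∧ 0 < condYX Q x y ∧ W x y = 0 := by
    rintro ⟨x, y, -, hV, hW⟩
    simp [condYX, h2 x y hW] at hV
  rw [exponentObjective, condDiv, if_neg hno, ← EReal.coe_add, mutualInfo_eq h0, realObjective]
  congr 2
  rw [entropyDiv, entropy_margX_eq, ← Finset.sum_neg_distrib, ← Finset.sum_sub_distrib,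
    ← Finset.sum_sub_distrib]
  refine Finset.sum_congr rfl fun x _ => ?_
  rw [Finset.mul_sum, ← Finset.sum_neg_distrib, ← Finset.sum_sub_distrib,
    ← Finset.sum_sub_distrib]
  refine Finset.sum_congr rfl fun y _ => ?_
  rcases (h0 x y).eq_or_lt with h | h
  · simp [condYX, ← h]
  · have h1 := h.trans_le (le_margX h0 x y)
    have hW : W x y ≠ 0 := fun hW => h.ne' (h2 x y hW)
    rw [← mul_assoc, condYX, mul_div_cancel₀ _ h1.ne', Real.log_div (by positivity) hW,
      Real.log_div h.ne' h1.ne', Real.negMulLog]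
    ring

theorem exponentObjective_eq_top {W : X → Y → ℝ} {p : X → ℝ} {Q : X → Y → ℝ}
    (hQ : Q ∈ jointsWithMarginal p) (hQ' : Q ∉ supportedJoints W) (R : ℝ) :
    exponentObjective W p R Q = ⊤ := by
  obtain ⟨h0, h1, rfl⟩ := hQ
  have hex : ∃ x y, W x y = 0 ∧ Q x y ≠ 0 := by
    by_contra h
    push Not at h
    exact hQ' ⟨h0, h1, h⟩
  obtain ⟨x, y, hW, hne⟩ := hex
  have hpos := (h0 x y).lt_of_ne' hne
  have hm := hpos.trans_le (le_margX h0 x y)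
  rw [exponentObjective, condDiv, if_pos ⟨x, y, hm, div_pos hpos hm, hW⟩]
  exact EReal.top_add_coe _

/-- The joint law `p x * W x y` is feasible, so the compact set is nonempty; outside the support of
`W` the objective is `⊤` and cannot compete. -/
theorem exists_minimizer {W : X → Y → ℝ} (hW : ∀ x, W x ∈ stdSimplex ℝ Y) {p : X → ℝ}
    (hp : p ∈ stdSimplex ℝ X) (R : ℝ) :
    ∃ Q ∈ supportedJoints W, margX Q = p ∧
      (∀ Q' ∈ supportedJoints W, margX Q' = p → realObjective W R Q ≤ realObjective W R Q') ∧
      IsRandomCodingExponent W p R (realObjective W R Q) := by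
  have hcomp : IsCompact (supportedJoints W ∩ {Q | margX Q = p}) :=
    (isCompact_supportedJoints W).inter_right (isClosed_eq continuous_margX continuous_const)
  have hmarg : margX (fun x y => p x * W x y) = p := by
    funext x; simp [margX, ← Finset.mul_sum, (hW x).2]
  have hne : (supportedJoints W ∩ {Q | margX Q = p}).Nonempty := by
    refine ⟨fun x y => p x * W x y, ⟨fun x y => mul_nonneg (hp.1 x) ((hW x).1 y), ?_,
      fun x y h => by simp [h]⟩, hmarg⟩
    simp [← Finset.mul_sum, (hW _).2, hp.2]
  obtain ⟨Q, ⟨hQ, hQp⟩, hmin⟩ := hcomp.exists_isMinOn hne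
    (((continuous_realObjective W).comp (Continuous.prodMk_left R)).continuousOn)
  have hmin' : ∀ Q' ∈ supportedJoints W, margX Q' = p →
      realObjective W R Q ≤ realObjective W R Q' := fun Q' h h' => hmin ⟨h, h'⟩
  refine ⟨Q, hQ, hQp, hmin', ⟨Q, ⟨hQ.1, hQ.2.1, hQp⟩, exponentObjective_eq hQ hQp R⟩, ?_⟩
  rintro _ ⟨Q', hQ', rfl⟩
  by_cases h : Q' ∈ supportedJoints W
  · rw [exponentObjective_eq h hQ'.2.2]
    exact EReal.coe_le_coe_iff.2 (hmin' Q' h hQ'.2.2)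
  · rw [exponentObjective_eq_top hQ' h]; exact le_top

/-- The minimum of the objective is lower semicontinuous in the marginal and the rate. -/
theorem eventually_lt_realObjective {W : X → Y → ℝ} {p : X → ℝ} {R m : ℝ}
    (hm : ∀ Q ∈ supportedJoints W, margX Q = p → m < realObjective W R Q) :
    ∀ᶠ s : (X → ℝ) × ℝ in 𝓝 (p, R), ∀ Q ∈ supportedJoints W, margX Q = s.1 →
      m < realObjective W s.2 Q := by
  refine (isCompact_supportedJoints W).eventually_forall_of_forall_eventually fun Q hQ => ?_
  -- If the marginal of `Q` is `p`, continuity keeps the objective above `m` nearby; otherwise the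
  -- marginal constraint fails nearby. Compactness makes the neighbourhood uniform in `Q`.
  by_cases h : margX Q = p
  · have hc : ContinuousAt (fun u : ((X → ℝ) × ℝ) × (X → Y → ℝ) => realObjective W u.1.2 u.2)
        ((p, R), Q) :=
      ContinuousAt.comp (f := fun u : ((X → ℝ) × ℝ) × (X → Y → ℝ) => (u.2, u.1.2))
        (continuous_realObjective W).continuousAt (by fun_prop)
    exact (hc.eventually_const_lt (hm Q hQ h)).mono fun u hu _ => hu
  · have hc : ContinuousAt (fun u : ((X → ℝ) × ℝ) × (X → Y → ℝ) => margX u.2) ((p, R), Q) :=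
      ContinuousAt.comp (f := fun u : ((X → ℝ) × ℝ) × (X → Y → ℝ) => u.2)
        continuous_margX.continuousAt (by fun_prop)
    have hc' : ContinuousAt (fun u : ((X → ℝ) × ℝ) × (X → Y → ℝ) => u.1.1) ((p, R), Q) := by
      fun_prop
    exact ((hc.ne_iff_eventually_ne hc').1 h).mono fun u hu h' => absurd h' hu

end Exponent

/-! ### Exponential size of the contribution of a joint type -/

section TypeBound

variable {X Y : Type*} [Fintype X] [Fintype Y] [DecidableEq X] [DecidableEq Y]

/-- The empirical distribution of a sequence of pairs as a joint distribution. -/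
def empiricalJoint {X Y : Type*} [DecidableEq X] [DecidableEq Y] {n : ℕ} (z : Fin n → X × Y) :
    X → Y → ℝ := fun a b => empirical z (a, b)

theorem margX_empiricalJoint {X Y : Type*} [Fintype Y] [DecidableEq X] [DecidableEq Y] {n : ℕ}
    (z : Fin n → X × Y) : margX (empiricalJoint z) = empirical fun t => (z t).1 :=
  funext fun a => sum_empirical_fst z a

theorem margY_empiricalJoint {X Y : Type*} [Fintype X] [DecidableEq X] [DecidableEq Y] {n : ℕ}
    (z : Fin n → X × Y) : margY (empiricalJoint z) = empirical fun t => (z t).2 :=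
  funext fun a => sum_empirical_snd z a

theorem empirical_nonneg {A : Type*} [DecidableEq A] {n : ℕ} (z : Fin n → A) (a : A) :
    0 ≤ empirical z a := by
  rw [empirical_eq]; positivity

theorem sum_empirical {A : Type*} [Fintype A] [DecidableEq A] {n : ℕ} (hn : 0 < n)
    (z : Fin n → A) : ∑ a, empirical z a = 1 := by
  simp only [empirical_eq, ← Finset.sum_div]
  rw [← Nat.cast_sum, sum_letterCount, div_self (by positivity)]

theorem empiricalJoint_mem_supportedJoints {W : X → Y → ℝ} {n : ℕ} (hn : 0 < n)
    {z : Fin n → X × Y} (h : ∀ t, W (z t).1 (z t).2 ≠ 0) :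
    empiricalJoint z ∈ supportedJoints W := by
  refine ⟨fun a b => empirical_nonneg z _, ?_, fun a b hab => ?_⟩
  · rw [← sum_empirical hn z, Fintype.sum_prod_type]; rfl
  · have : letterCount z (a, b) = 0 := by
      rw [letterCount, Finset.card_eq_zero, Finset.filter_eq_empty_iff]
      intro t _ ht
      exact h t (by rw [ht]; exact hab)
    rw [empiricalJoint, empirical_eq, this]; simp

theorem log_chanProb {W : X → Y → ℝ} {n : ℕ} (hn : 0 < n) {z : Fin n → X × Y}
    (h : ∀ t, W (z t).1 (z t).2 ≠ 0) :
    Real.log (chanProb W (fun t => (z t).1) fun t => (z t).2) =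
      n * ∑ a, ∑ b, empiricalJoint z a b * Real.log (W a b) := by
  rw [chanProb, Real.log_prod fun t _ => h t, ← Fintype.sum_prod_type'
    (f := fun a b => empiricalJoint z a b * Real.log (W a b)), Finset.mul_sum]
  rw [← Finset.sum_fiberwise_of_maps_to (g := z) (t := Finset.univ) fun t _ => Finset.mem_univ _]
  refine Finset.sum_congr rfl fun a _ => ?_
  rw [Finset.sum_congr rfl (g := fun _ => Real.log (W a.1 a.2)) fun t ht => by
    rw [(Finset.mem_filter.1 ht).2], Finset.sum_const, nsmul_eq_mul, ← mul_assoc]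
  congr 1
  exact (mul_empirical hn z a).symm

theorem log_min_one {u : ℝ} (hu : 0 < u) : Real.log (min 1 u) = min 0 (Real.log u) := by
  rcases le_total 1 u with h | h
  · rw [min_eq_left h, min_eq_left (Real.log_nonneg h), Real.log_one]
  · rw [min_eq_right h, min_eq_right (Real.log_nonpos hu.le h)]

theorem typeBound_pos {W : X → Y → ℝ} (hW : ∀ x y, 0 ≤ W x y) {N : ℕ} (hN : 0 < N) {n : ℕ}
    {z : Fin n → X × Y} (h : ∀ t, W (z t).1 (z t).2 ≠ 0) :
    0 < typeBound W N (fun t => (z t).1) fun t => (z t).2 := by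
  have h1 : 0 < chanProb W (fun t => (z t).1) fun t => (z t).2 :=
    Finset.prod_pos fun t _ => (hW _ _).lt_of_ne' (h t)
  have h2 : 0 < (typeClass n (empirical z)).card := Finset.card_pos.2 ⟨z, mem_typeClass.2 rfl⟩
  have h3 : 0 < (typeClass n (empirical fun t => (z t).1)).card :=
    Finset.card_pos.2 ⟨_, mem_typeClass.2 rfl⟩
  have h4 : 0 < (condClass (fun t => (z t).1) fun t => (z t).2).card :=
    Finset.card_pos.2 ⟨_, mem_condClass.2 rfl⟩
  unfold typeBound
  have : (0 : ℝ) < min 1 (N * (((condClass (fun t => (z t).1) fun t => (z t).2).card : ℝ) /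
      (typeClass n (empirical fun t => (z t).1)).card)) := by
    refine lt_min one_pos ?_
    positivity
  have h2' : (0 : ℝ) < (typeClass n (empirical fun t => ((z t).1, (z t).2))).card := by
    exact_mod_cast h2
  positivity

/-- Logarithms of class sizes are traded for entropies. Two of them occur outside the minimum and
three inside, and `min` is 1-Lipschitz, hence the factor 5. -/
theorem abs_log_typeBound_add_le {W : X → Y → ℝ} (hW : ∀ x y, 0 ≤ W x y) {N : ℕ} (hN : 0 < N)
    {n : ℕ} (hn : 0 < n) {z : Fin n → X × Y} (h : ∀ t, W (z t).1 (z t).2 ≠ 0) :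
    |Real.log (typeBound W N (fun t => (z t).1) fun t => (z t).2) +
        n * realObjective W (Real.log N / n) (empiricalJoint z)| ≤
      5 * ((Fintype.card (X × Y) + Fintype.card X + Fintype.card Y + 1) *
        (1 + Real.log (n + 1))) := by
  have hn' : (0 : ℝ) < n := by exact_mod_cast hn
  have h1 : 0 < chanProb W (fun t => (z t).1) fun t => (z t).2 :=
    Finset.prod_pos fun t _ => (hW _ _).lt_of_ne' (h t)
  have h2 : (0 : ℝ) < (typeClass n (empirical z)).card := by
    exact_mod_cast Finset.card_pos.2 ⟨z, mem_typeClass.2 rfl⟩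
  have h3 : (0 : ℝ) < (typeClass n (empirical fun t => (z t).1)).card := by
    exact_mod_cast Finset.card_pos.2 ⟨_, mem_typeClass.2 rfl⟩
  have h4 : (0 : ℝ) < (condClass (fun t => (z t).1) fun t => (z t).2).card := by
    exact_mod_cast Finset.card_pos.2 ⟨fun t => (z t).1,
      mem_condClass (x₀ := fun t => (z t).1) (y := fun t => (z t).2).2 rfl⟩
  have h5 : (0 : ℝ) < (typeClass n (empirical fun t => (z t).2)).card := by
    exact_mod_cast Finset.card_pos.2 ⟨_, mem_typeClass.2 rfl⟩
  have hN' : (0 : ℝ) < N := by exact_mod_cast hN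
  have hu : (0 : ℝ) < N * (((condClass (fun t => (z t).1) fun t => (z t).2).card : ℝ) /
      (typeClass n (empirical fun t => (z t).1)).card) := by positivity
  have hcond : Real.log (condClass (fun t => (z t).1) fun t => (z t).2).card =
      Real.log (typeClass n (empirical z)).card -
        Real.log (typeClass n (empirical fun t => (z t).2)).card := by
    have := card_condClass_mul (fun t => (z t).1) fun t => (z t).2
    have h' : ((typeClass n (empirical fun t => (z t).2)).card : ℝ) *
        (condClass (fun t => (z t).1) fun t => (z t).2).card = (typeClass n (empirical z)).card := by
      exact_mod_cast this
    rw [← h', Real.log_mul h5.ne' h4.ne']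
    ring
  have hlog : Real.log (typeBound W N (fun t => (z t).1) fun t => (z t).2) =
      Real.log (typeClass n (empirical z)).card -
        Real.log (typeClass n (empirical fun t => (z t).1)).card +
        n * ∑ a, ∑ b, empiricalJoint z a b * Real.log (W a b) +
        min 0 (Real.log N + (Real.log (typeClass n (empirical z)).card -
          Real.log (typeClass n (empirical fun t => (z t).2)).card -
          Real.log (typeClass n (empirical fun t => (z t).1)).card)) := by
    unfold typeBound
    rw [Real.log_mul (mul_ne_zero (div_ne_zero h2.ne' h3.ne') h1.ne')
      (lt_min one_pos hu).ne', Real.log_mul (div_ne_zero h2.ne' h3.ne') h1.ne',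
      Real.log_div h2.ne' h3.ne', log_min_one hu, log_chanProb hn h, Real.log_mul hN'.ne'
      (div_ne_zero h4.ne' h3.ne'), Real.log_div h4.ne' h3.ne', hcond]
  have hobj : n * realObjective W (Real.log N / n) (empiricalJoint z) =
      n * entropy (empirical fun t => (z t).1) - n * entropy (empirical z) -
        n * ∑ a, ∑ b, empiricalJoint z a b * Real.log (W a b) +
        max 0 (n * entropy (empirical fun t => (z t).1) +
          n * entropy (empirical fun t => (z t).2) - n * entropy (empirical z) -
          Real.log N) := by
    have hent : ∑ a, ∑ b, Real.negMulLog (empiricalJoint z a b) = entropy (empirical z) := by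
      rw [entropy, Fintype.sum_prod_type]; rfl
    rw [realObjective, entropyDiv, entropyInfo, margX_empiricalJoint, margY_empiricalJoint, hent,
      mul_add, mul_max_of_nonneg _ _ hn'.le, mul_zero]
    congr 1
    · ring
    · congr 1
      field_simp
  have hL : 0 ≤ 1 + Real.log ((n : ℝ) + 1) := by
    have := Real.log_nonneg (x := (n : ℝ) + 1) (by linarith)
    linarith
  set δ := ((Fintype.card (X × Y) : ℝ) + Fintype.card X + Fintype.card Y + 1) *
    (1 + Real.log (n + 1)) with hδ
  have eXY : |Real.log (typeClass n (empirical z)).card - n * entropy (empirical z)| ≤ δ := by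
    refine (abs_log_card_typeClass_sub_le hn z).trans (mul_le_mul_of_nonneg_right ?_ hL)
    linarith [Nat.cast_nonneg (α := ℝ) (Fintype.card X),
      Nat.cast_nonneg (α := ℝ) (Fintype.card Y)]
  have eX := (abs_log_card_typeClass_sub_le hn fun t => (z t).1).trans
    (mul_le_mul_of_nonneg_right (a := 1 + Real.log ((n : ℝ) + 1))
      (by linarith [Nat.cast_nonneg (α := ℝ) (Fintype.card (X × Y)),
        Nat.cast_nonneg (α := ℝ) (Fintype.card Y)] : (Fintype.card X : ℝ) + 1 ≤
        (Fintype.card (X × Y) : ℝ) + Fintype.card X + Fintype.card Y + 1) hL)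
  have eY := (abs_log_card_typeClass_sub_le hn fun t => (z t).2).trans
    (mul_le_mul_of_nonneg_right (a := 1 + Real.log ((n : ℝ) + 1))
      (by linarith [Nat.cast_nonneg (α := ℝ) (Fintype.card (X × Y)),
        Nat.cast_nonneg (α := ℝ) (Fintype.card X)] : (Fintype.card Y : ℝ) + 1 ≤
        (Fintype.card (X × Y) : ℝ) + Fintype.card X + Fintype.card Y + 1) hL)
  rw [← hδ] at eX eY
  rw [hlog, hobj]
  rw [abs_le] at eXY eX eY ⊢
  obtain ⟨a1, a2⟩ := eXY
  obtain ⟨b1, b2⟩ := eX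
  obtain ⟨c1, c2⟩ := eY
  rw [min_def, max_def]
  constructor <;> split_ifs <;> linarith

/-- A sequence can be completed to a sequence of pairs whose conditional type approximates a given
channel and is supported in its support. -/
theorem exists_pairs_near {V : X → Y → ℝ} (hV : ∀ x, V x ∈ stdSimplex ℝ Y) {n : ℕ} (hn : 0 < n)
    (x : Fin n → X) :
    ∃ z : Fin n → X × Y, (empirical fun t => (z t).1) = empirical x ∧
      (∀ t, V (z t).1 (z t).2 ≠ 0) ∧
      ∀ a b, |empiricalJoint z a b - empirical x a * V a b| ≤ (Fintype.card Y : ℝ) / n := by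
  have hb : ∀ a, ∃ b, V a b ≠ 0 := fun a => by
    by_contra h
    push Not at h
    have := (hV a).2
    simp [h] at this
  choose b₀ hb₀ using hb
  set m := letterCount x with hm
  have hfl : ∀ a b, ((⌊(m a : ℝ) * V a b⌋₊ : ℕ) : ℝ) ≤ m a * V a b := fun a b =>
    Nat.floor_le (mul_nonneg (by positivity) ((hV a).1 b))
  have hsumV : ∀ a, m a * V a (b₀ a) + ∑ b ∈ Finset.univ.erase (b₀ a), (m a : ℝ) * V a b = m a :=
    fun a => by
      rw [Finset.add_sum_erase Finset.univ (fun b => (m a : ℝ) * V a b) (Finset.mem_univ _),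
        ← Finset.mul_sum, (hV a).2, mul_one]
  have hle : ∀ a, ∑ b ∈ Finset.univ.erase (b₀ a), ⌊(m a : ℝ) * V a b⌋₊ ≤ m a := fun a => by
    have h1 := Finset.sum_le_sum fun b (_ : b ∈ Finset.univ.erase (b₀ a)) => hfl a b
    have h2 : 0 ≤ (m a : ℝ) * V a (b₀ a) := mul_nonneg (by positivity) ((hV a).1 _)
    have h3 := hsumV a
    have : ((∑ b ∈ Finset.univ.erase (b₀ a), ⌊(m a : ℝ) * V a b⌋₊ : ℕ) : ℝ) ≤ m a := by
      push_cast; linarith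
    exact_mod_cast this
  -- The counts are rounded down, and the remainder goes to a letter `b₀ a` of positive probability:
  -- no zero of `V` is used, and only that letter accumulates the rounding errors, at most
  -- `Fintype.card Y`.
  let k : X × Y → ℕ := fun ab => if ab.2 = b₀ ab.1 then
    m ab.1 - ∑ b ∈ Finset.univ.erase (b₀ ab.1), ⌊(m ab.1 : ℝ) * V ab.1 b⌋₊
    else ⌊(m ab.1 : ℝ) * V ab.1 ab.2⌋₊
  have hk0 : ∀ a, k (a, b₀ a) = m a - ∑ b ∈ Finset.univ.erase (b₀ a), ⌊(m a : ℝ) * V a b⌋₊ :=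
    fun a => if_pos rfl
  have hk1 : ∀ a b, b ≠ b₀ a → k (a, b) = ⌊(m a : ℝ) * V a b⌋₊ := fun a b h => if_neg h
  have hksum : ∀ a, ∑ b, k (a, b) = m a := fun a => by
    rw [← Finset.add_sum_erase Finset.univ _ (Finset.mem_univ (b₀ a)), hk0,
      Finset.sum_congr rfl fun b hb => hk1 a b (Finset.ne_of_mem_erase hb)]
    exact Nat.sub_add_cancel (hle a)
  obtain ⟨z, hz⟩ := exists_empirical_eq (n := n) k (by
    rw [Fintype.sum_prod_type]; simp only [hksum]; exact sum_letterCount x)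
  refine ⟨z, ?_, ?_, ?_⟩
  · funext a
    rw [← sum_empirical_fst]
    simp only [empirical_eq, ← Finset.sum_div, hz]
    rw [← hm, ← hksum a, Nat.cast_sum]
  · intro t ht
    have h1 : 0 < letterCount z (z t) := Finset.card_pos.2 ⟨t, by simp⟩
    have hne : (z t).2 ≠ b₀ (z t).1 := fun h => hb₀ (z t).1 (h ▸ ht)
    have h2 := hk1 (z t).1 (z t).2 hne
    rw [ht, mul_zero, Nat.floor_zero] at h2
    rw [hz] at h1
    exact h1.ne' h2
  · intro a b
    have hn' : (0 : ℝ) < n := by exact_mod_cast hn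
    have hY : (1 : ℝ) ≤ Fintype.card Y := by
      exact_mod_cast Fintype.card_pos_iff.2 ⟨b⟩
    have hclose : ∀ b, |((⌊(m a : ℝ) * V a b⌋₊ : ℕ) : ℝ) - m a * V a b| ≤ 1 := fun b => by
      have h1 := hfl a b
      have h2 := (Nat.lt_floor_add_one ((m a : ℝ) * V a b)).le
      rw [abs_le]; constructor <;> linarith
    have hkey : |(k (a, b) : ℝ) - m a * V a b| ≤ Fintype.card Y := by
      by_cases h : b = b₀ a
      · subst h
        rw [hk0, Nat.cast_sub (hle a), Nat.cast_sum]
        have h3 : (m a : ℝ) - ∑ b ∈ Finset.univ.erase (b₀ a), ((⌊(m a : ℝ) * V a b⌋₊ : ℕ) : ℝ) -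
            m a * V a (b₀ a) = -∑ b ∈ Finset.univ.erase (b₀ a),
              (((⌊(m a : ℝ) * V a b⌋₊ : ℕ) : ℝ) - m a * V a b) := by
          rw [Finset.sum_sub_distrib]; linarith [hsumV a]
        rw [h3, abs_neg]
        refine (Finset.abs_sum_le_sum_abs _ _).trans
          ((Finset.sum_le_sum fun b _ => hclose b).trans ?_)
        rw [Finset.sum_const, nsmul_eq_mul, mul_one]
        exact_mod_cast Finset.card_le_univ _
      · rw [hk1 a b h]; exact (hclose b).trans hY
    have : empiricalJoint z a b - empirical x a * V a b = ((k (a, b) : ℝ) - m a * V a b) / n := by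
      rw [empiricalJoint, empirical_eq, empirical_eq, hz]; ring
    rw [this, abs_div, abs_of_pos hn']
    gcongr

end TypeBound

/-! ### Exponents -/

theorem hasExponent_of_bounds {l : Filter ℕ} (hl : l ≤ atTop) {P : ℕ → ℝ} {E : ℝ}
    (h : ∀ ε > 0, ∀ᶠ n : ℕ in l, Real.exp (-(n * (E + ε))) ≤ P n ∧ P n ≤ Real.exp (-(n * (E - ε)))) :
    HasExponent l P E := by
  refine ⟨(h 1 one_pos).mono fun n hn => (Real.exp_pos _).trans_le hn.1, ?_⟩
  rw [Metric.tendsto_nhds]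
  intro ε hε
  filter_upwards [h (ε / 2) (by positivity), hl (eventually_gt_atTop 0)] with n ⟨h1, h2⟩ hn
  have hn' : (0 : ℝ) < n := by exact_mod_cast hn
  have hP := (Real.exp_pos _).trans_le h1
  have h3 := Real.log_le_log (Real.exp_pos _) h1
  have h4 := Real.log_le_log hP h2
  rw [Real.log_exp] at h3 h4
  have h5 : -Real.log (P n) / n ≤ E + ε / 2 := by rw [div_le_iff₀ hn']; linarith
  have h6 : E - ε / 2 ≤ -Real.log (P n) / n := by rw [le_div_iff₀ hn']; linarith
  rw [Real.dist_eq, abs_lt]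
  constructor <;> linarith

theorem tendsto_one_add_log_div : Tendsto (fun n : ℕ => (1 + Real.log ((n : ℝ) + 1)) / n)
    atTop (𝓝 0) := by
  have h1 : Tendsto (fun x : ℝ => Real.log x / x) atTop (𝓝 0) := by
    simpa using Real.tendsto_pow_log_div_mul_add_atTop 1 0 1 one_ne_zero
  have h2 : Tendsto (fun n : ℕ => (n : ℝ) + 1) atTop atTop :=
    tendsto_atTop_add_const_right _ _ tendsto_natCast_atTop_atTop
  have h3 : Tendsto (fun n : ℕ => 1 / (n : ℝ)) atTop (𝓝 0) := tendsto_one_div_atTop_nhds_zero_nat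
  have h4 := h3.add ((h1.comp h2).mul ((tendsto_const_nhds (x := (1 : ℝ))).add h3))
  simp only [add_zero, mul_one] at h4
  refine h4.congr' ?_
  filter_upwards [eventually_gt_atTop 0] with n hn
  have hn' : (0 : ℝ) < n := by exact_mod_cast hn
  simp only [Function.comp]
  field_simp

section Asymptotics

variable {X Y : Type*} [Fintype X] [Fintype Y] [DecidableEq X] [DecidableEq Y]

/-- Along a sequence of types converging to `p` the contribution of some joint type has an
exponent of at most the minimum of the objective. -/
theorem eventually_exists_typeBound_ge {W : X → Y → ℝ} (hW : ∀ x, W x ∈ stdSimplex ℝ Y)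
    {l : Filter ℕ} (hl : l ≤ atTop) {P : ℕ → X → ℝ} {p : X → ℝ} (hp : Tendsto P l (𝓝 p))
    (hP : ∀ᶠ n in l, (typeClass n (P n)).Nonempty) {N : ℕ → ℕ} (hN : ∀ n, 0 < N n) {R : ℝ}
    (hR : Tendsto (fun n => Real.log (N n) / n) l (𝓝 R)) {Q : X → Y → ℝ}
    (hQ : Q ∈ supportedJoints W) (hQp : margX Q = p) {ε : ℝ} (hε : 0 < ε) :
    ∀ᶠ n : ℕ in l, ∃ (x : Fin n → X) (y : Fin n → Y), empirical x = P n ∧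
      Real.exp (-(n * (realObjective W R Q + ε))) ≤ typeBound W (N n) x y / 12 := by
  -- Where `p a = 0` the law `Q` fixes no conditional, yet `P n a` may be positive, so an admissible
  -- row is needed; `W a` serves.
  let V : X → Y → ℝ := fun a b => if p a = 0 then W a b else Q a b / p a
  have hV : ∀ a, V a ∈ stdSimplex ℝ Y := fun a => by
    by_cases h : p a = 0
    · simpa only [V, h, if_true] using hW a
    · simp only [V, h, if_false]
      have hpa : 0 ≤ p a := hQp ▸ Finset.sum_nonneg fun b _ => hQ.1 a b
      refine ⟨fun b => div_nonneg (hQ.1 a b) hpa, ?_⟩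
      rw [← Finset.sum_div, ← hQp]
      exact div_self (by rwa [← hQp] at h)
  have hVW : ∀ a b, V a b ≠ 0 → W a b ≠ 0 := fun a b h hw => by
    apply h
    simp [V, hw, hQ.2.2 a b hw]
  have hVQ : ∀ a b, p a * V a b = Q a b := fun a b => by
    by_cases h : p a = 0
    · have h1 := le_margX hQ.1 a b
      rw [hQp, h] at h1
      rw [h, zero_mul]
      exact (hQ.1 a b).antisymm h1
    · simp only [V, h, if_false]
      field_simp
  -- The sequences live in spaces depending on `n`; their joint types are extracted into one fixed
  -- space so that limits make sense, with 0 as a dummy at unusable `n`.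
  have hex : ∀ n, ∃ Q' : X → Y → ℝ, 0 < n → (typeClass n (P n)).Nonempty →
      ∃ z : Fin n → X × Y, empiricalJoint z = Q' ∧ (empirical fun t => (z t).1) = P n ∧
        (∀ t, V (z t).1 (z t).2 ≠ 0) ∧
        ∀ a b, |Q' a b - P n a * V a b| ≤ (Fintype.card Y : ℝ) / n := fun n => by
    by_cases h : 0 < n ∧ (typeClass n (P n)).Nonempty
    · obtain ⟨x, hx⟩ := h.2
      obtain ⟨z, h1, h2, h3⟩ := exists_pairs_near hV h.1 x
      rw [mem_typeClass.1 hx] at h1 h3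
      exact ⟨empiricalJoint z, fun _ _ => ⟨z, rfl, h1, h2, h3⟩⟩
    · exact ⟨0, fun h1 h2 => absurd ⟨h1, h2⟩ h⟩
  choose Q' hQ' using hex
  have hpos : ∀ᶠ n : ℕ in l, 0 < n := hl (eventually_gt_atTop 0)
  have hlim : Tendsto Q' l (𝓝 Q) := by
    rw [tendsto_pi_nhds]; intro a
    rw [tendsto_pi_nhds]; intro b
    have h1 : Tendsto (fun n => P n a * V a b) l (𝓝 (Q a b)) := by
      rw [← hVQ]; exact ((tendsto_pi_nhds.1 hp) a).mul_const _
    have h2 : Tendsto (fun n : ℕ => (Fintype.card Y : ℝ) / n) l (𝓝 0) :=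
      (tendsto_const_div_atTop_nhds_zero_nat _).mono_left hl
    have h3 : Tendsto (fun n => Q' n a b - P n a * V a b) l (𝓝 0) := by
      refine squeeze_zero_norm' ?_ h2
      filter_upwards [hpos, hP] with n hn hPn
      obtain ⟨z, -, -, -, h⟩ := hQ' n hn hPn
      exact h a b
    simpa using h3.add h1
  have hJ : Tendsto (fun n => realObjective W (Real.log (N n) / n) (Q' n)) l
      (𝓝 (realObjective W R Q)) :=
    Tendsto.comp (f := fun n => (Q' n, Real.log (N n) / (n : ℝ)))
      ((continuous_realObjective W).tendsto (Q, R)) (hlim.prodMk_nhds hR)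
  -- The 12 absorbs the factor `1/12`, since `log 12 ≤ 12` and `1 + log (n + 1) ≥ 1`.
  set C : ℝ := 5 * ((Fintype.card (X × Y) : ℝ) + Fintype.card X + Fintype.card Y + 1) + 12 with hC
  have hL : Tendsto (fun n : ℕ => C * ((1 + Real.log ((n : ℝ) + 1)) / n)) l (𝓝 0) := by
    simpa using (tendsto_one_add_log_div.mono_left hl).const_mul C
  filter_upwards [hpos, hP, hJ.eventually_lt_const (lt_add_of_pos_right _ (half_pos hε)),
    hL.eventually_lt_const (half_pos hε)] with n hn hPn hJn hLn
  have hn' : (0 : ℝ) < n := by exact_mod_cast hn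
  obtain ⟨z, hz, hz1, hz2, -⟩ := hQ' n hn hPn
  have hzW : ∀ t, W (z t).1 (z t).2 ≠ 0 := fun t => hVW _ _ (hz2 t)
  have hW0 : ∀ x y, 0 ≤ W x y := fun x => (hW x).1
  refine ⟨fun t => (z t).1, fun t => (z t).2, hz1, ?_⟩
  have h1 := (abs_le.1 (abs_log_typeBound_add_le hW0 (hN n) hn hzW)).1
  have h2 := typeBound_pos hW0 (hN n) hzW
  rw [hz] at h1
  rw [← Real.le_log_iff_exp_le (by positivity), Real.log_div h2.ne' (by norm_num)]
  have h3 : Real.log 12 ≤ 12 := (Real.log_le_self (by norm_num))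
  have h4 : 0 ≤ Real.log ((n : ℝ) + 1) := Real.log_nonneg (by linarith)
  rw [mul_div_assoc', div_lt_iff₀ hn'] at hLn
  have h5 := mul_le_mul_of_nonneg_left hJn.le hn'.le
  rw [hC, add_mul] at hLn
  linarith

/-- Along a sequence of types converging to `p` the contributions of all joint types have an
exponent of at least the minimum of the objective. -/
theorem eventually_forall_typeBound_le {W : X → Y → ℝ} (hW : ∀ x y, 0 ≤ W x y)
    {l : Filter ℕ} (hl : l ≤ atTop) {P : ℕ → X → ℝ} {p : X → ℝ} (hp : Tendsto P l (𝓝 p))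
    {N : ℕ → ℕ} (hN : ∀ n, 0 < N n) {R : ℝ}
    (hR : Tendsto (fun n => Real.log (N n) / n) l (𝓝 R)) {E : ℝ}
    (hE : ∀ Q ∈ supportedJoints W, margX Q = p → E ≤ realObjective W R Q) {ε : ℝ} (hε : 0 < ε) :
    ∀ᶠ n : ℕ in l, ∀ (x : Fin n → X) (y : Fin n → Y), empirical x = P n →
      typeBound W (N n) x y ≤ Real.exp (-(n * (E - ε)) + 5 * ((Fintype.card (X × Y) +
        Fintype.card X + Fintype.card Y + 1) * (1 + Real.log (n + 1)))) := by
  have hev := (hp.prodMk_nhds hR).eventually (eventually_lt_realObjective (m := E - ε)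
    fun Q hQ hQp => (sub_lt_self E hε).trans_le (hE Q hQ hQp))
  filter_upwards [hev, hl (eventually_gt_atTop 0)] with n hn hn0 x y hx
  have hn' : (0 : ℝ) < n := by exact_mod_cast hn0
  by_cases h : ∀ t, W (x t) (y t) ≠ 0
  · have h1 := (abs_le.1 (abs_log_typeBound_add_le hW (hN n) hn0
      (z := fun t => (x t, y t)) h)).2
    have h2 := hn (empiricalJoint fun t => (x t, y t))
      (empiricalJoint_mem_supportedJoints hn0 (z := fun t => (x t, y t)) h)
      ((margX_empiricalJoint _).trans hx)
    have h3 := mul_le_mul_of_nonneg_left h2.le hn'.le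
    rw [← Real.log_le_iff_le_exp (typeBound_pos hW (hN n) (z := fun t => (x t, y t)) h)]
    simp only at h1 h3
    linarith
  · push Not at h
    obtain ⟨t, ht⟩ := h
    have : chanProb W x y = 0 := Finset.prod_eq_zero (Finset.mem_univ t) ht
    rw [typeBound, this, mul_zero, zero_mul]
    positivity

end Asymptotics

end BinIndex

end

/-! ### The exponents of both decoders. -/

theorem theorem1 {X Y : Type*} [Fintype X] [Fintype Y] [DecidableEq X]
    -- the memoryless channel
    (W : X → Y → ℝ) (hW : ∀ x, W x ∈ stdSimplex ℝ Y)
    -- the input distribution, the block lengths, and the types used at these block lengths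
    (PX : X → ℝ) (hPX : PX ∈ stdSimplex ℝ X)
    (S : Set ℕ) (hS : S.Infinite)
    (P : ℕ → X → ℝ) (hP : ∀ n ∈ S, (BinIndex.typeClass n (P n)).Nonempty)
    (hPlim : Tendsto P (atTop ⊓ 𝓟 S) (𝓝 PX))
    -- the number `M n` of bins and their size `M₂ n`
    (R₁ R₂ : ℝ) (hR₂ : 0 ≤ R₂) (hR : R₂ ≤ R₁)
    (M M₂ : ℕ → ℕ) (hM : ∀ n, 2 ≤ M n) (hM₂ : ∀ n, 1 ≤ M₂ n)
    (hMlim : Tendsto (fun n : ℕ => Real.log (M n) / (n : ℝ)) (atTop ⊓ 𝓟 S) (𝓝 (R₁ - R₂)))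
    (hM₂lim : Tendsto (fun n : ℕ => Real.log (M₂ n) / (n : ℝ)) (atTop ⊓ 𝓟 S) (𝓝 R₂))
    -- the optimal bin index decoders and the maximum likelihood decoders
    (wOpt : ∀ n, BinIndex.Codebook X n (M n) (M₂ n) → (Fin n → Y) → Fin (M n))
    (hOpt : ∀ n, BinIndex.IsOptimalBinDecoder W (wOpt n))
    (iML : ∀ n, BinIndex.Codebook X n (M n) (M₂ n) → (Fin n → Y) → Fin (M n * M₂ n))
    (hML : ∀ n, BinIndex.IsMLDecoder W (iML n)) :
    ∃ E : ℝ, BinIndex.IsRandomCodingExponent W PX R₁ E ∧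
      BinIndex.HasExponent (atTop ⊓ 𝓟 S)
        (fun n => BinIndex.avgErrorProb W (P n) (wOpt n)) E ∧
      BinIndex.HasExponent (atTop ⊓ 𝓟 S)
        (fun n => BinIndex.avgErrorProb W (P n) (fun c y => (iML n c y).divNat)) E := by
  classical
  have hl : atTop ⊓ 𝓟 S ≤ (atTop : Filter ℕ) := inf_le_left
  have hW0 : ∀ x y, 0 ≤ W x y := fun x => (hW x).1
  have hPev : ∀ᶠ n in atTop ⊓ 𝓟 S, (BinIndex.typeClass n (P n)).Nonempty :=
    Filter.mem_of_superset (Filter.mem_inf_of_right (Filter.mem_principal_self S)) hP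
  have hN : ∀ n, 0 < M n * M₂ n := fun n =>
    Nat.mul_pos (by linarith [hM n]) (hM₂ n)
  have hrate : Tendsto (fun n : ℕ => Real.log ((M n * M₂ n : ℕ) : ℝ) / n) (atTop ⊓ 𝓟 S)
      (𝓝 R₁) := by
    have h := hMlim.add hM₂lim
    rw [sub_add_cancel] at h
    refine h.congr fun n => ?_
    have h1 : (M n : ℝ) ≠ 0 := by have := hM n; positivity
    have h2 : (M₂ n : ℝ) ≠ 0 := by have := hM₂ n; positivity
    rw [Nat.cast_mul, Real.log_mul h1 h2, add_div]
  obtain ⟨Q, hQ, hQp, hmin, hexp⟩ := BinIndex.exists_minimizer hW hPX R₁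
  set E := BinIndex.realObjective W R₁ Q with hE
  have hlower : ∀ ε > 0, ∀ᶠ n : ℕ in atTop ⊓ 𝓟 S,
      Real.exp (-(n * (E + ε))) ≤ BinIndex.avgErrorProb W (P n) (wOpt n) := by
    intro ε hε
    filter_upwards [BinIndex.eventually_exists_typeBound_ge hW hl hPlim hPev hN hrate hQ hQp hε]
      with n hn
    obtain ⟨x, y, hx, h⟩ := hn
    exact h.trans (BinIndex.typeBound_div_le_avgErrorProb hW0 (hM n) (hM₂ n) (wOpt n) x y hx)
  have hupper : ∀ ε > 0, ∀ᶠ n : ℕ in atTop ⊓ 𝓟 S,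
      BinIndex.avgErrorProb W (P n) (fun c y => (iML n c y).divNat) ≤
        Real.exp (-(n * (E - ε))) := by
    intro ε hε
    -- The last summand pays for the squared polynomial number of joint types.
    set C : ℝ := 5 * ((Fintype.card (X × Y) : ℝ) + Fintype.card X + Fintype.card Y + 1) +
      2 * Fintype.card (X × Y) with hC
    have hL : Tendsto (fun n : ℕ => C * ((1 + Real.log ((n : ℝ) + 1)) / n)) (atTop ⊓ 𝓟 S)
        (𝓝 0) := by
      simpa using (BinIndex.tendsto_one_add_log_div.mono_left hl).const_mul C
    filter_upwards [hPev, hl (eventually_gt_atTop 0), hL.eventually_lt_const (half_pos hε),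
      BinIndex.eventually_forall_typeBound_le hW0 hl hPlim hN hrate hmin (half_pos hε)]
      with n hPn hn0 hLn hn
    have hn' : (0 : ℝ) < n := by exact_mod_cast hn0
    refine (BinIndex.avgErrorProb_isMLDecoder_le hW0 (hM n) (hM₂ n) hPn (hML n)
      (Real.exp_pos _).le hn).trans ?_
    have hK : ((n + 1 : ℝ) ^ Fintype.card (X × Y)) ^ 2 =
        Real.exp (2 * Fintype.card (X × Y) * Real.log (n + 1)) := by
      rw [← pow_mul, ← Real.exp_log (by positivity : (0 : ℝ) < (n + 1 : ℝ) ^ _), Real.log_pow]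
      congr 1
      push_cast
      ring
    rw [hK, ← Real.exp_add, Real.exp_le_exp]
    rw [mul_div_assoc', div_lt_iff₀ hn', hC, add_mul] at hLn
    have h0 : (0 : ℝ) ≤ Fintype.card (X × Y) := by positivity
    linarith
  have hle : ∀ n, BinIndex.avgErrorProb W (P n) (wOpt n) ≤
      BinIndex.avgErrorProb W (P n) (fun c y => (iML n c y).divNat) := fun n =>
    BinIndex.avgErrorProb_le_of_isOptimal W (hM₂ n) (P n) (hOpt n) _
  refine ⟨E, hexp, BinIndex.hasExponent_of_bounds hl fun ε hε => ?_,
    BinIndex.hasExponent_of_bounds hl fun ε hε => ?_⟩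
  · filter_upwards [hlower ε hε, hupper ε hε] with n h1 h2 using ⟨h1, (hle n).trans h2⟩
  · filter_upwards [hlower ε hε, hupper ε hε] with n h1 h2 using ⟨h1.trans (hle n), h2⟩
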